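/- **Notation.** A partition in $(N,M)$ is a sequence of integers $M\ge p_N\ge p_{N-1}\ge\dots\ge p_1\ge 0$; its weight $\mathrm{wt}$ is the sum of its parts. For $a,b,\alpha,\beta\ge 0$ with $a+b>0$, $\alpha+\beta>0$, let $R(N,M,a,b,\alpha,\beta)=\sum q^{\mathrm{wt}(\bar q)+\mathrm{wt}(\bar p)}$, the sum over all pairs $(\bar q,\bar p)$ of partitions in $(N,M)$ such that $\bar p_i-\bar q_{i+1-a}\ge 1-\alpha$ for $\max\{1,a\}\le i\le\min\{N,N+a-1\}$, $\bar q_i-\bar p_{i+1-b}\ge 1-\beta$ for $\max\{1,b\}\le i\le\min\{N,N+b-1\}$, and, if $a=0$, $\bar q_1\le\alpha-1$ and $\bar p_N\ge M-\alpha+1$, and, if $b=0$, $\bar p_1\le\beta-1$ and $\bar q_N\ge M-\beta+1$ (where, if $N=0$, a part with subscript $0$ is read as $0$ and a part with subscript $1$ as $M$). Put $(q)_n=\prod_{i=1}^n(1-q^i)$ and $\left[{P\atop N}\right]=\frac{(q)_P}{(q)_N(q)_{P-N}}$ if $P\ge N\ge0$, and $0$ otherwise. The continued fraction of a pair $(s:r)$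 of positive coprime integers (or $s=1$, $r=0$) is empty for $(1:0)$, and otherwise is $c_1=\lfloor s/r\rfloor$ followed by the continued fraction of $(r:s-c_1r)$; in addition $(c_1,\dots,c_{k-1},1)$ with $k>1$ is identified with $(c_1,\dots,c_{k-1}+1)$. **Theorem.** Let $p,p'$ be positive coprime integers and let $(p':p)$ have continued fraction $(c_1,\dots,c_{t-1},c_t+2)$ with $t\ge1$ and all $c_k\ge 0$. Let $1\le u\le t$ and $1\le d\le c_u$, and let $(s:r)$ have continued fraction $(c_1,\dots,c_{u-1},d)$. Let $N\ge0$, and set $(f_1,\dots,f_{t+1})=(c_1,\dots,c_{u-1},d,c_u-d,c_{u+1},\dots,c_t)$. Consider all sequences $n^{(1)},\dots,n^{(x)}$ of partitions, $u\le x\le t+1$, where $n^{(k)}$ has $f_k$ parts $n_{k,0}\ge n_{k,1}\ge\dots\ge n_{k,f_k}\ge0$ and $\mathrm{wt}(n^{(k)})\le w_k$ for $1\le k\le x$; $\mathrm{wt}(n^{(x)})=w_x$; $\mathrm{wt}(n^{(u)})<w_u$ if $u<x$; $n_{k,f_k}>0$ if $u<k<x$; and $n_{x,f_x}=0$ if $x<t+1$.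 Here $w_1=\infty$, $n_{1,0}=N$, and recursively $$w_k=n_{k-1,f_{k-1}}\ (2\le k\le u),\quad w_{u+1}=w_u-1-\mathrm{wt}(n^{(u)}),\quad w_k=n_{k-1,f_{k-1}}-1\ (u+2\le k\le x),$$ $$n_{k,0}=w_{k-1}-\mathrm{wt}(n^{(k-1)})\ (2\le k\le u),\quad n_{u+1,0}=n_{u,f_u}+1,\quad n_{k,0}=w_{k-1}+1-\mathrm{wt}(n^{(k-1)})\ (u+2\le k\le x),$$ with $\infty\pm a=\infty$ for integers $a$. There are only finitely many such sequences. Moreover, the limit being that of formal power series in $q$ (coefficientwise) and the sums being over all these sequences: if $u>1$, then $$\lim_{M\to\infty}R(N,M,r,p-r,s,p'-s)=\sum q^{E}\,\frac1{(q)_{2n_{1,f_1}}}\prod_{i=1}^{f_1}\frac1{(q)_{n_{1,i-1}-n_{1,i}}}\prod_{k=2}^{x}\prod_{i=1+\delta_{2,k}}^{f_k}\left[{2(w_k-\sum_{j=1}^in_{k,j})+n_{k,i-1}+n_{k,i}\atop n_{k,i-1}-n_{k,i}}\right];$$ if $u=1$, then $$\lim_{M\to\infty}R(N,M,r,p-r,s,p'-s)=\sum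 q^{E}\,\frac1{(q)_{2(n_{2,f_2}-1)}}\prod_{i=1}^{f_1}\frac1{(q)_{n_{1,i-1}-n_{1,i}}}\prod_{i=1}^{f_2}\frac1{(q)_{n_{2,i-1}-n_{2,i}}}\prod_{k=3}^{x}\prod_{i=1+\delta_{3,k}}^{f_k}\left[{2(w_k-\sum_{j=1}^in_{k,j})+n_{k,i-1}+n_{k,i}\atop n_{k,i-1}-n_{k,i}}\right],$$ where $$E=n_{u,d}+\sum_{k=1}^{u}\sum_{i=1}^{f_k}n_{k,i}^2+\sum_{k=u+1}^{x}\sum_{i=1}^{f_k}n_{k,i}(n_{k,i}-1).$$ (If $u=1$ every sequence in the sum has $x\ge3$ and $n_{2,f_2}\ge1$; an empty sum is $0$.) -/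

import Mathlib

open Filter Topology
open scoped PowerSeries.WithPiTopology

namespace Burge

/-! ## Restricted partition pairs -/

/-- The part `p_i` of a partition `M ≥ p_N ≥ ⋯ ≥ p_1 ≥ 0` in `(N, M)`, where `p_i` is the value of
the monotone function `p` at the index `i - 1`.  Boundary conventions: `p_i = 0` for `i ≤ 0` and
`p_i = M` for `i > N` (they are only used for partitions without parts, i.e. when `N = 0`). -/
def boxPart {N M : ℕ} (p : Fin N → Fin (M + 1)) (i : ℤ) : ℤ :=
  if i ≤ 0 then 0
  else if h : i.toNat - 1 < N then ((p ⟨i.toNat - 1, h⟩ : ℕ) : ℤ)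
  else (M : ℤ)

/-- `(q, p)` is a restricted partition pair in `(N₁, M₁) × (N₂, M₂)` for the parameters
`a, b, α, β`. -/
structure IsRestrictedPair {N₁ M₁ N₂ M₂ : ℕ} (a b α β : ℤ)
    (q : Fin N₁ → Fin (M₁ + 1)) (p : Fin N₂ → Fin (M₂ + 1)) : Prop where
  monotone_left : Monotone q
  monotone_right : Monotone p
  ineq_left : ∀ i : ℤ, max 1 a ≤ i → i ≤ min (N₂ : ℤ) (N₁ + a - 1) →
    1 - α ≤ boxPart p i - boxPart q (i + 1 - a)
  ineq_right : ∀ i : ℤ, max 1 b ≤ i → i ≤ min (N₁ : ℤ) (N₂ + b - 1) →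
    1 - β ≤ boxPart q i - boxPart p (i + 1 - b)
  special_a_zero : a = 0 → boxPart q 1 ≤ α - 1
  special_b_zero : b = 0 → boxPart p 1 ≤ β - 1
  special_a_max : a = (N₂ : ℤ) - N₁ → M₁ - α + 1 ≤ boxPart p N₂
  special_b_max : b = (N₁ : ℤ) - N₂ → M₂ - β + 1 ≤ boxPart q N₁

open Classical in
/-- The generating function `R(N₁, M₁, N₂, M₂, a, b, α, β)`: the sum of `q ^ (wt q + wt p)` over
all restricted partition pairs `(q, p)`. -/
noncomputable def genFun (N₁ M₁ N₂ M₂ : ℕ) (a b α β : ℤ) : Polynomial ℤ :=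
  ∑ x : (Fin N₁ → Fin (M₁ + 1)) × (Fin N₂ → Fin (M₂ + 1)) with
    IsRestrictedPair a b α β x.1 x.2,
    Polynomial.X ^ ((∑ i, (x.1 i : ℕ)) + ∑ i, (x.2 i : ℕ))

/-- `R(N, M, a, b, α, β) = R(N, M, N, M, a, b, α, β)`. -/
noncomputable def R (N M : ℕ) (a b α β : ℤ) : Polynomial ℤ :=
  genFun N M N M a b α β

/-! ## `q`-factorials and Gaussian polynomials, as formal power series in `q` -/

/-- `(q)_n = (1 - q)(1 - q²)⋯(1 - qⁿ)`. -/
noncomputable def qFact (n : ℕ) : PowerSeries ℤ :=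
  ∏ i ∈ Finset.range n, (1 - PowerSeries.X ^ (i + 1))

/-- `1 / (q)_n`. -/
noncomputable def invQFact (n : ℕ) : PowerSeries ℤ :=
  PowerSeries.invOfUnit (qFact n) 1

theorem qFact_mul_invQFact (n : ℕ) : qFact n * invQFact n = 1 := by
  apply PowerSeries.mul_invOfUnit
  simp [qFact, map_prod]

/-- The Gaussian polynomial `(q)_P / ((q)_N (q)_{P-N})` if `P ≥ N ≥ 0`, and `0` otherwise. -/
noncomputable def gauss (P N : ℤ) : PowerSeries ℤ :=
  if 0 ≤ N ∧ N ≤ P then qFact P.toNat * invQFact N.toNat * invQFact (P - N).toNat else 0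

/-! ## Continued fractions -/

/-- The continued fraction of the pair `s : r`: empty if `r = 0`, otherwise `⌊s / r⌋` followed by
the continued fraction of `r : s - ⌊s / r⌋ r`. -/
def contFrac (s r : ℕ) : List ℕ :=
  if _h : r = 0 then [] else (s / r) :: contFrac r (s % r)
termination_by r
decreasing_by exact Nat.mod_lt _ (Nat.pos_of_ne_zero _h)

/-- `l` is a continued fraction of `s : r`, where `s`, `r` are positive coprime integers or
`s = 1`, `r = 0`.  As usual `(c_1, …, c_{t-1}, 1)` is also allowed in place of
`(c_1, …, c_{t-1} + 1)`. -/
def IsContFrac (s r : ℕ) (l : List ℕ) : Prop :=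
  0 < s ∧ s.Coprime r ∧
    (l = contFrac s r ∨ ∃ l' e, l = l' ++ [e, 1] ∧ contFrac s r = l' ++ [e + 1])

/-! ## Sequences of partitions

A sequence `n^{(1)}, …, n^{(x)}` of partitions is a list `S` of lists; `x = S.length`, and the
`k`-th list holds the parts `n_{k,1}, n_{k,2}, …` of `n^{(k)}`. -/

/-- `(f_1, …, f_{t+1}) = (c_1, …, c_{u-1}, d, c_u - d, c_{u+1}, …, c_t)`. -/
def fSeq (c : ℕ → ℕ) (u d : ℕ) (k : ℕ) : ℕ :=
  if k < u then c k else if k = u then d else if k = u + 1 then c u - d else c (k - 1)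

/-- The `k`-th partition `n^{(k)}` (`k ≥ 1`). -/
def nPartition (S : List (List ℕ)) (k : ℕ) : List ℕ := S.getD (k - 1) []

/-- `n_{k,i}` for `k ≥ 1`, `i ≥ 1`. -/
def nPart (S : List (List ℕ)) (k i : ℕ) : ℕ := (nPartition S k).getD (i - 1) 0

/-- `wt(n^{(k)})`. -/
def nWt (S : List (List ℕ)) (k : ℕ) : ℕ := (nPartition S k).sum

/-- The pair `(w_{j+1}, n_{j+1,0})`, defined recursively from `(w_1, n_{1,0}) = (w₁, n₁₀)`.
Here `n_{k,f_k}` means `n_{k,0}` if `f_k = 0`.  The values lie in `ℕ∞`, where `⊤ ± a = ⊤`.  The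
subtractions never truncate for the sequences satisfying `Admissible` below. -/
def bounds (f : ℕ → ℕ) (u : ℕ) (w₁ n₁₀ : ℕ∞) (S : List (List ℕ)) : ℕ → ℕ∞ × ℕ∞
  | 0 => (w₁, n₁₀)
  | j + 1 =>
    let k := j + 1
    let w := (bounds f u w₁ n₁₀ S j).1
    let n0 := (bounds f u w₁ n₁₀ S j).2
    let last : ℕ∞ := if f k = 0 then n0 else (nPart S k (f k) : ℕ∞)
    let wt : ℕ∞ := (nWt S k : ℕ∞)
    if k < u then (last, w - wt)
    else if k = u then (w - 1 - wt, last + 1)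
    else (last - 1, w + 1 - wt)

/-- `w_k` for `k ≥ 1`. -/
def wBound (f : ℕ → ℕ) (u : ℕ) (w₁ n₁₀ : ℕ∞) (S : List (List ℕ)) (k : ℕ) : ℕ∞ :=
  (bounds f u w₁ n₁₀ S (k - 1)).1

/-- `n_{k,i}` for `k ≥ 1`, `i ≥ 0`, including the recursively defined `n_{k,0}`. -/
def nExt (f : ℕ → ℕ) (u : ℕ) (w₁ n₁₀ : ℕ∞) (S : List (List ℕ)) (k i : ℕ) : ℕ∞ :=
  if i = 0 then (bounds f u w₁ n₁₀ S (k - 1)).2 else (nPart S k i : ℕ∞)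

/-- The conditions on the sequences of partitions over which the fermionic sums are taken. -/
structure Admissible (f : ℕ → ℕ) (t u : ℕ) (w₁ n₁₀ : ℕ∞) (S : List (List ℕ)) : Prop where
  le_length : u ≤ S.length
  length_le : S.length ≤ t + 1
  length_part : ∀ k, 1 ≤ k → k ≤ S.length → (nPartition S k).length = f k
  antitone : ∀ k, 1 ≤ k → k ≤ S.length → ∀ i, 1 ≤ i → i ≤ f k →
    nExt f u w₁ n₁₀ S k i ≤ nExt f u w₁ n₁₀ S k (i - 1)
  wt_le : ∀ k, 1 ≤ k → k ≤ S.length → (nWt S k : ℕ∞) ≤ wBound f u w₁ n₁₀ S k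
  wt_last : (nWt S S.length : ℕ∞) = wBound f u w₁ n₁₀ S S.length
  wt_u_lt : u < S.length → (nWt S u : ℕ∞) < wBound f u w₁ n₁₀ S u
  pos : ∀ k, u < k → k < S.length → 0 < nExt f u w₁ n₁₀ S k (f k)
  last_zero : S.length < t + 1 → nExt f u w₁ n₁₀ S S.length (f S.length) = 0

/-- The exponent
`n_{u,d} + ∑_{k=1}^u ∑_{i=1}^{f_k} n_{k,i}² + ∑_{k=u+1}^x ∑_{i=1}^{f_k} n_{k,i}(n_{k,i} - 1)`. -/
def fermExponent (f : ℕ → ℕ) (u d : ℕ) (S : List (List ℕ)) : ℕ :=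
  nPart S u d
    + ∑ k ∈ Finset.Icc 1 u, ∑ i ∈ Finset.Icc 1 (f k), nPart S k i ^ 2
    + ∑ k ∈ Finset.Icc (u + 1) S.length, ∑ i ∈ Finset.Icc 1 (f k),
        nPart S k i * (nPart S k i - 1)

/-- The Gaussian
`[ 2 (w_k - ∑_{j=1}^i n_{k,j}) + n_{k,i-1} + n_{k,i} ; n_{k,i-1} - n_{k,i} ]`,
meant for `k`, `i` with `w_k` and `n_{k,i-1}` finite. -/
noncomputable def gaussFactor (f : ℕ → ℕ) (u : ℕ) (w₁ n₁₀ : ℕ∞) (S : List (List ℕ))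
    (k i : ℕ) : PowerSeries ℤ :=
  gauss
    (2 * (((wBound f u w₁ n₁₀ S k).toNat : ℤ) - ∑ j ∈ Finset.Icc 1 i, (nPart S k j : ℤ))
      + ((nExt f u w₁ n₁₀ S k (i - 1)).toNat : ℤ) + ((nExt f u w₁ n₁₀ S k i).toNat : ℤ))
    (((nExt f u w₁ n₁₀ S k (i - 1)).toNat : ℤ) - ((nExt f u w₁ n₁₀ S k i).toNat : ℤ))

/-- `∏_{i=1}^{f_k} 1 / (q)_{n_{k,i-1} - n_{k,i}}`. -/
noncomputable def qFactLevel (f : ℕ → ℕ) (u : ℕ) (w₁ n₁₀ : ℕ∞) (S : List (List ℕ))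
    (k : ℕ) : PowerSeries ℤ :=
  ∏ i ∈ Finset.Icc 1 (f k),
    invQFact ((nExt f u w₁ n₁₀ S k (i - 1)).toNat - (nExt f u w₁ n₁₀ S k i).toNat)

/-- `∏_{k=m}^x ∏_{i=1+δ_{m,k}}^{f_k}` of the Gaussians. -/
noncomputable def gaussLevels (f : ℕ → ℕ) (u : ℕ) (w₁ n₁₀ : ℕ∞) (S : List (List ℕ))
    (m : ℕ) : PowerSeries ℤ :=
  ∏ k ∈ Finset.Icc m S.length, ∏ i ∈ Finset.Icc (1 + if k = m then 1 else 0) (f k),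
    gaussFactor f u w₁ n₁₀ S k i

/-- The summand for `u > 1` (where `w_1 = ∞`, `n_{1,0} = N`). -/
noncomputable def termOfOneLt (f : ℕ → ℕ) (u d N : ℕ) (S : List (List ℕ)) : PowerSeries ℤ :=
  PowerSeries.X ^ fermExponent f u d S
    * invQFact (2 * (nExt f u ⊤ N S 1 (f 1)).toNat)
    * qFactLevel f u ⊤ N S 1
    * gaussLevels f u ⊤ N S 2

/-- The summand for `u = 1` (where `w_1 = ∞`, `n_{1,0} = N`).  The second factor is
`1 / (q)_{2 w_3}` with `w_3 = n_{2,f_2} - 1`; every admissible sequence has `x ≥ 3` and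
`n_{2,f_2} ≥ 1` in this case. -/
noncomputable def termOfEqOne (f : ℕ → ℕ) (d N : ℕ) (S : List (List ℕ)) : PowerSeries ℤ :=
  PowerSeries.X ^ fermExponent f 1 d S
    * invQFact (2 * ((nExt f 1 ⊤ N S 2 (f 2)).toNat - 1))
    * qFactLevel f 1 ⊤ N S 1
    * qFactLevel f 1 ⊤ N S 2
    * gaussLevels f 1 ⊤ N S 3

end Burge

/-!
View a pair of partitions as a pair of lattice paths. Two identities relate the generating
functions.
* The Burge transform
  `R(N, M, a, b, α + a, β + b) = ∑ₓ q^(x²) [2 M + N - x ; N - x] R(x, M - x, a, b, α, β)`. For boxes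
  of arbitrary sizes, both sides satisfy the recurrence that removes the last step of one of the
  paths; for the right-hand side this is Pascal's rule for Gaussian polynomials.
* Conjugation of both partitions, which exchanges `(N, a, b)` and `(M, α, β)`.

Hence `f` Burge transforms followed by a conjugation attach the partial quotient `f` to the
continued fractions of both `(α : a)` and `(α + β : a + b)`, and the summation indices of the
transforms at level `k` are the parts of `n^{(k)}`. The continued fraction of `(α : a)` is exhausted
at level `u`, where `a = 1` and `α = 0`. There `p_i > q_i`, and subtracting `1` from all `p_i` leads
to `a = α = 1`. A further part of maximal size in `q` turns `a = 1` into `a = 0`, and as the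
partitions then have `n` and `n - 1` parts, the Burge transform has the exponent `x (x - 1)`: these
are the levels `k > u`.

The limit can be taken term by term, because `[2 w + n - x ; n - x]` tends to `1 / (q)_{n - x}` as
`w → ∞`, and to `1 / (q)_{2 w}` as `n → ∞`. The former occurs at the levels with `w_k = ∞`, the
latter at the first part of the level after them.
-/

namespace Burge

section BoxPart

variable {N M : ℕ}

theorem boxPart_of_nonpos (p : Fin N → Fin (M + 1)) {i : ℤ} (hi : i ≤ 0) : boxPart p i = 0 := by
  simp [boxPart, hi]

theorem boxPart_of_lt (p : Fin N → Fin (M + 1)) {i : ℤ} (hi : (N : ℤ) < i) :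
    boxPart p i = M := by
  have hpos : ¬ i ≤ 0 := by omega
  have hge : ¬ i.toNat - 1 < N := by omega
  simp [boxPart, hpos, hge]

theorem boxPart_natCast_add_one (p : Fin N → Fin (M + 1)) {j : ℕ} (hj : j < N) :
    boxPart p ((j : ℤ) + 1) = ((p ⟨j, hj⟩ : ℕ) : ℤ) := by
  have hpos : ¬ (j : ℤ) + 1 ≤ 0 := by omega
  simp [boxPart, hpos, hj]

theorem nonpos_or_exists_natCast_add_one_or_lt (N : ℕ) (i : ℤ) :
    i ≤ 0 ∨ (∃ j : ℕ, j < N ∧ i = j + 1) ∨ (N : ℤ) < i := by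
  by_cases hi : 0 < i ∧ i ≤ N
  · exact Or.inr (Or.inl ⟨(i - 1).toNat, by omega, by omega⟩)
  · omega

theorem boxPart_nonneg (p : Fin N → Fin (M + 1)) (i : ℤ) : 0 ≤ boxPart p i := by
  unfold boxPart
  split_ifs <;> omega

theorem boxPart_le (p : Fin N → Fin (M + 1)) (i : ℤ) : boxPart p i ≤ M := by
  unfold boxPart
  split_ifs <;> omega

theorem monotone_boxPart {p : Fin N → Fin (M + 1)} (hp : Monotone p) : Monotone (boxPart p) := by
  intro i j hij
  rcases nonpos_or_exists_natCast_add_one_or_lt N i with hi | ⟨i', hi', rfl⟩ | hi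
  · exact (boxPart_of_nonpos p hi).trans_le (boxPart_nonneg p j)
  · rcases nonpos_or_exists_natCast_add_one_or_lt N j with hj | ⟨j', hj', rfl⟩ | hj
    · omega
    · have hle : p ⟨i', hi'⟩ ≤ p ⟨j', hj'⟩ := hp (Fin.mk_le_mk.2 (by omega))
      rw [boxPart_natCast_add_one p hi', boxPart_natCast_add_one p hj']
      exact_mod_cast hle
    · exact (boxPart_le p _).trans_eq (boxPart_of_lt p hj).symm
  · rw [boxPart_of_lt p (hi.trans_le hij), boxPart_of_lt p hi]

theorem monotone_boxPart_iff (p : Fin N → Fin (M + 1)) : Monotone (boxPart p) ↔ Monotone p := by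
  refine ⟨fun h i j hij => ?_, monotone_boxPart⟩
  have hle := h (show ((i : ℕ) : ℤ) + 1 ≤ ((j : ℕ) : ℤ) + 1 by
    exact_mod_cast Nat.succ_le_succ hij)
  rw [boxPart_natCast_add_one p i.2, boxPart_natCast_add_one p j.2] at hle
  exact_mod_cast hle

theorem boxPart_snoc_last (p : Fin N → Fin (M + 1)) :
    boxPart (Fin.snoc p (Fin.last M) : Fin (N + 1) → Fin (M + 1)) = boxPart p := by
  funext i
  rcases nonpos_or_exists_natCast_add_one_or_lt (N + 1) i with hi | ⟨j, hj, rfl⟩ | hi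
  · rw [boxPart_of_nonpos _ hi, boxPart_of_nonpos _ hi]
  · rw [boxPart_natCast_add_one _ hj]
    rcases Nat.lt_succ_iff_lt_or_eq.mp hj with h | rfl
    · rw [boxPart_natCast_add_one _ h]
      simp [Fin.snoc, h]
    · rw [boxPart_of_lt p (by omega)]
      simp [Fin.snoc]
  · rw [boxPart_of_lt _ hi, boxPart_of_lt _ (by push_cast at hi; omega)]

theorem boxPart_cons_zero (p : Fin N → Fin (M + 1)) (i : ℤ) :
    boxPart (Fin.cons 0 p : Fin (N + 1) → Fin (M + 1)) (i + 1) = boxPart p i := by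
  rcases nonpos_or_exists_natCast_add_one_or_lt N i with hi | ⟨j, hj, rfl⟩ | hi
  · rw [boxPart_of_nonpos p hi]
    rcases eq_or_lt_of_le hi with rfl | hneg
    · simpa using boxPart_natCast_add_one (Fin.cons 0 p : Fin (N + 1) → Fin (M + 1)) N.succ_pos
    · rw [boxPart_of_nonpos _ (by omega)]
  · rw [boxPart_natCast_add_one _ hj]
    exact_mod_cast boxPart_natCast_add_one (Fin.cons 0 p : Fin (N + 1) → Fin (M + 1))
      (Nat.succ_lt_succ hj)
  · rw [boxPart_of_lt _ hi, boxPart_of_lt _ (by push_cast; omega)]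

theorem boxPart_castSucc (p : Fin N → Fin (M + 1)) {i : ℤ} (hi : i ≤ N) :
    boxPart (fun j => (p j).castSucc) i = boxPart p i := by
  rcases nonpos_or_exists_natCast_add_one_or_lt N i with hi | ⟨j, hj, rfl⟩ | hi'
  · rw [boxPart_of_nonpos _ hi, boxPart_of_nonpos _ hi]
  · rw [boxPart_natCast_add_one _ hj, boxPart_natCast_add_one _ hj, Fin.val_castSucc]
  · omega

theorem boxPart_succ (p : Fin N → Fin (M + 1)) {i : ℤ} (hi : 0 < i) :
    boxPart (fun j => (p j).succ) i = boxPart p i + 1 := by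
  rcases nonpos_or_exists_natCast_add_one_or_lt N i with hi | ⟨j, hj, rfl⟩ | hi'
  · omega
  · rw [boxPart_natCast_add_one _ hj, boxPart_natCast_add_one _ hj, Fin.val_succ, Nat.cast_succ]
  · rw [boxPart_of_lt _ hi', boxPart_of_lt _ hi', Nat.cast_succ]

theorem boxPart_rev (p : Fin N → Fin (M + 1)) (i : ℤ) :
    boxPart (fun j => (p j.rev).rev) i = M - boxPart p (N + 1 - i) := by
  rcases nonpos_or_exists_natCast_add_one_or_lt N i with hi | ⟨j, hj, rfl⟩ | hi
  · rw [boxPart_of_nonpos _ hi, boxPart_of_lt _ (by omega), sub_self]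
  · have hrev : Fin.rev (⟨j, hj⟩ : Fin N) = ⟨N - 1 - j, by omega⟩ := by
      ext
      simp only [Fin.val_rev]
      omega
    rw [boxPart_natCast_add_one _ hj, hrev, Fin.val_rev,
      show (N : ℤ) + 1 - (j + 1) = ((N - 1 - j : ℕ) : ℤ) + 1 by omega,
      boxPart_natCast_add_one _ (by omega)]
    omega
  · rw [boxPart_of_lt _ hi, boxPart_of_nonpos _ (by omega), sub_zero]

theorem boxPart_zero_of_le {i : ℤ} (hi : i ≤ N) :
    boxPart (0 : Fin N → Fin (M + 1)) i = 0 := by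
  rcases nonpos_or_exists_natCast_add_one_or_lt N i with hi | ⟨j, hj, rfl⟩ | hi'
  · rw [boxPart_of_nonpos _ hi]
  · rw [boxPart_natCast_add_one _ hj]
    simp
  · omega

end BoxPart

/-- The inequalities defining a restricted partition pair, for two arbitrary sequences `Q`, `P` of
integer parts in place of the functions `boxPart q`, `boxPart p`. -/
structure PairCond (N₁ M₁ N₂ M₂ a b α β : ℤ) (Q P : ℤ → ℤ) : Prop where
  left : ∀ i : ℤ, max 1 a ≤ i → i ≤ min N₂ (N₁ + a - 1) → 1 - α ≤ P i - Q (i + 1 - a)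
  right : ∀ i : ℤ, max 1 b ≤ i → i ≤ min N₁ (N₂ + b - 1) → 1 - β ≤ Q i - P (i + 1 - b)
  a_zero : a = 0 → Q 1 ≤ α - 1
  b_zero : b = 0 → P 1 ≤ β - 1
  a_max : a = N₂ - N₁ → M₁ - α + 1 ≤ P N₂
  b_max : b = N₁ - N₂ → M₂ - β + 1 ≤ Q N₁

namespace PairCond

variable {N₁ M₁ N₂ M₂ a b α β : ℤ} {Q P : ℤ → ℤ}

theorem symm (h : PairCond N₁ M₁ N₂ M₂ a b α β Q P) : PairCond N₂ M₂ N₁ M₁ b a β α P Q :=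
  ⟨h.right, h.left, h.b_zero, h.a_zero, h.b_max, h.a_max⟩

theorem of_snoc (h : PairCond (N₁ + 1) M₁ N₂ M₂ a b α β Q P) (hN₁ : 0 ≤ N₁) (hN₂ : 0 ≤ N₂)
    (hP : 0 ≤ P 0) (hlast : Q (N₁ + 1) = M₁) (ha : 0 ≤ a) (hb : -b ≤ N₂ - (N₁ + 1)) :
    PairCond N₁ M₁ N₂ M₂ a b α β Q P := by
  refine ⟨fun i h₁ h₂ => h.left i h₁ (by omega), fun i h₁ h₂ => h.right i h₁ (by omega),
    h.a_zero, h.b_zero, fun ha_max => ?_, fun hb_max => by omega⟩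
  rcases hN₂.eq_or_lt with rfl | hpos
  · have hQ := h.a_zero (by omega)
    obtain rfl : N₁ = 0 := by omega
    rw [zero_add] at hlast
    omega
  · have hle := h.left N₂ (by omega) (by omega)
    rw [show N₂ + 1 - a = N₁ + 1 by omega, hlast] at hle
    omega

theorem snoc (h : PairCond N₁ M₁ N₂ M₂ a b α β Q P) (hP : ∀ i, P i ≤ M₂)
    (hlast : Q (N₁ + 1) = M₁) (ha : N₂ - (N₁ + 1) < a) (hβ : M₂ - M₁ < β) :
    PairCond (N₁ + 1) M₁ N₂ M₂ a b α β Q P := by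
  refine ⟨fun i h₁ h₂ => ?_, fun i h₁ h₂ => ?_, h.a_zero, h.b_zero, by omega, fun _ => by omega⟩
  · rcases le_or_gt i (N₁ + a - 1) with hi | hi
    · exact h.left i h₁ (by omega)
    · obtain rfl : i = N₂ := by omega
      have hmax := h.a_max (by omega)
      rw [show i + 1 - a = N₁ + 1 by omega, hlast]
      omega
  · rcases le_or_gt i N₁ with hi | hi
    · exact h.right i h₁ (by omega)
    · obtain rfl : i = N₁ + 1 := by omega
      have hle := hP (N₁ + 1 + 1 - b)
      omega

theorem of_eq_on_le (h : PairCond N₁ M₁ N₂ M₂ a b α β Q P) {M₁' : ℤ} {Q' : ℤ → ℤ}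
    (hQ : ∀ i ≤ N₁, Q' i = Q i) (hN₂ : 0 ≤ N₂) (ha : N₂ - N₁ < a) :
    PairCond N₁ M₁' N₂ M₂ a b α β Q' P := by
  refine ⟨fun i h₁ h₂ => ?_, fun i h₁ h₂ => ?_, fun h₁ => ?_, h.b_zero, by omega, fun h₁ => ?_⟩ <;>
    rw [hQ _ (by omega)]
  · exact h.left i h₁ h₂
  · exact h.right i h₁ h₂
  · exact h.a_zero h₁
  · exact h.b_max h₁

end PairCond

section IsRestrictedPair

variable {N₁ M₁ N₂ M₂ : ℕ} {a b α β : ℤ}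

theorem isRestrictedPair_iff {q : Fin N₁ → Fin (M₁ + 1)} {p : Fin N₂ → Fin (M₂ + 1)} :
    IsRestrictedPair a b α β q p ↔
      Monotone q ∧ Monotone p ∧ PairCond N₁ M₁ N₂ M₂ a b α β (boxPart q) (boxPart p) :=
  ⟨fun h => ⟨h.1, h.2, h.3, h.4, h.5, h.6, h.7, h.8⟩,
    fun ⟨hq, hp, h⟩ => ⟨hq, hp, h.1, h.2, h.3, h.4, h.5, h.6⟩⟩

theorem isRestrictedPair_comm {q : Fin N₁ → Fin (M₁ + 1)} {p : Fin N₂ → Fin (M₂ + 1)} :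
    IsRestrictedPair a b α β q p ↔ IsRestrictedPair b a β α p q := by
  simp only [isRestrictedPair_iff]
  exact ⟨fun h => ⟨h.2.1, h.1, h.2.2.symm⟩, fun h => ⟨h.2.1, h.1, h.2.2.symm⟩⟩

theorem isRestrictedPair_snoc_last (q : Fin N₁ → Fin (M₁ + 1)) (p : Fin N₂ → Fin (M₂ + 1))
    (ha : 0 ≤ a) (hxa : (N₂ : ℤ) - (N₁ + 1) < a) (hxb : -b ≤ (N₂ : ℤ) - (N₁ + 1))
    (hy : (M₂ : ℤ) - M₁ < β) :
    IsRestrictedPair a b α β (Fin.snoc q (Fin.last M₁) : Fin (N₁ + 1) → Fin (M₁ + 1)) p ↔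
      IsRestrictedPair a b α β q p := by
  have hlast : boxPart q (N₁ + 1) = M₁ := boxPart_of_lt q (by omega)
  rw [isRestrictedPair_iff, isRestrictedPair_iff, ← monotone_boxPart_iff, ← monotone_boxPart_iff q,
    boxPart_snoc_last, Nat.cast_succ]
  refine and_congr_right fun _ => and_congr_right fun _ => ⟨fun h => ?_, fun h => ?_⟩
  · exact h.of_snoc (by omega) (by omega) (boxPart_nonneg p 0) hlast ha hxb
  · exact h.snoc (boxPart_le p) hlast hxa hy

theorem isRestrictedPair_castSucc (q : Fin N₁ → Fin (M₁ + 1)) (p : Fin N₂ → Fin (M₂ + 1))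
    (hxa : (N₂ : ℤ) - N₁ < a) :
    IsRestrictedPair a b α β (fun i => (q i).castSucc) p ↔ IsRestrictedPair a b α β q p := by
  have hmono : Monotone (fun i => (q i).castSucc) ↔ Monotone q := by
    simp only [Monotone, Fin.castSucc_le_castSucc_iff]
  rw [isRestrictedPair_iff, isRestrictedPair_iff, hmono]
  refine and_congr_right fun _ => and_congr_right fun _ => ⟨fun h => ?_, fun h => ?_⟩
  · exact h.of_eq_on_le (fun _ hi => (boxPart_castSucc q hi).symm) (by omega) hxa
  · exact h.of_eq_on_le (fun _ hi => boxPart_castSucc q hi) (by omega) hxa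

end IsRestrictedPair

theorem sum_filter_eq_sum_filter_of_injective {A ι κ : Type*} [AddCommMonoid A] [Fintype ι]
    [Fintype κ] {s : ι → Prop} {t : κ → Prop} [DecidablePred s] [DecidablePred t] {e : ι → κ}
    (he : Function.Injective e) (hst : ∀ x, t (e x) ↔ s x) (hrange : ∀ y, t y → y ∈ Set.range e)
    (g : κ → A) : ∑ y with t y, g y = ∑ x with s x, g (e x) := by
  refine (Finset.sum_nbij e (fun x hx => ?_) he.injOn (fun y hy => ?_) fun _ _ => rfl).symm
  · rw [Finset.mem_filter_univ] at hx ⊢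
    exact (hst x).2 hx
  · obtain ⟨x, rfl⟩ := hrange y (by simpa using hy)
    exact ⟨x, by simpa [hst] using hy, rfl⟩

open Classical in
/-- The sum of `φ (wt q) (wt p)` over all restricted partition pairs `(q, p)`. -/
noncomputable def pairSum {A : Type*} [AddCommMonoid A] (N₁ M₁ N₂ M₂ : ℕ) (a b α β : ℤ)
    (φ : ℤ → ℤ → A) : A :=
  ∑ x : (Fin N₁ → Fin (M₁ + 1)) × (Fin N₂ → Fin (M₂ + 1)) with
    IsRestrictedPair a b α β x.1 x.2,
    φ (∑ i, ((x.1 i : ℕ) : ℤ)) (∑ i, ((x.2 i : ℕ) : ℤ))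

section PairSum

variable {A : Type*} [AddCommMonoid A] {N₁ M₁ N₂ M₂ : ℕ} {a b α β : ℤ}

theorem pairSum_swap (φ : ℤ → ℤ → A) :
    pairSum N₁ M₁ N₂ M₂ a b α β φ = pairSum N₂ M₂ N₁ M₁ b a β α (fun i j => φ j i) := by
  unfold pairSum
  refine Finset.sum_nbij' Prod.swap Prod.swap ?_ ?_ ?_ ?_ ?_ <;>
    simp [isRestrictedPair_comm (a := a)]

open Classical in
theorem sum_filter_last_eq_pairSum (φ : ℤ → ℤ → A)
    (ha : 0 ≤ a) (hxa : (N₂ : ℤ) - (N₁ + 1) < a) (hxb : -b ≤ (N₂ : ℤ) - (N₁ + 1))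
    (hy : (M₂ : ℤ) - M₁ < β) :
    (∑ x : (Fin (N₁ + 1) → Fin (M₁ + 1)) × (Fin N₂ → Fin (M₂ + 1)) with
      IsRestrictedPair a b α β x.1 x.2 ∧ x.1 (Fin.last N₁) = Fin.last M₁,
      φ (∑ i, ((x.1 i : ℕ) : ℤ)) (∑ i, ((x.2 i : ℕ) : ℤ)))
    = pairSum N₁ M₁ N₂ M₂ a b α β (fun i j => φ (M₁ + i) j) := by
  rw [sum_filter_eq_sum_filter_of_injective
    (s := fun x : (Fin N₁ → Fin (M₁ + 1)) × (Fin N₂ → Fin (M₂ + 1)) =>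
      IsRestrictedPair a b α β x.1 x.2)
    (e := fun x => ((Fin.snoc x.1 (Fin.last M₁) : Fin (N₁ + 1) → Fin (M₁ + 1)), x.2))]
  · refine Finset.sum_congr rfl fun x _ => ?_
    simp [Fin.sum_univ_castSucc, add_comm]
  · rintro ⟨q, p⟩ ⟨q', p'⟩ h
    simpa using h
  · simp [isRestrictedPair_snoc_last _ _ ha hxa hxb hy]
  · rintro ⟨q, p⟩ ⟨-, hlast⟩
    exact ⟨(Fin.init q, p), Prod.ext (hlast ▸ Fin.snoc_init_self q) rfl⟩

open Classical in
theorem sum_filter_ne_last_eq_pairSum (φ : ℤ → ℤ → A) (hxa : (N₂ : ℤ) - N₁ < a) :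
    (∑ x : (Fin N₁ → Fin (M₁ + 1 + 1)) × (Fin N₂ → Fin (M₂ + 1)) with
      IsRestrictedPair a b α β x.1 x.2 ∧ ∀ i, x.1 i ≠ Fin.last (M₁ + 1),
      φ (∑ i, ((x.1 i : ℕ) : ℤ)) (∑ i, ((x.2 i : ℕ) : ℤ)))
    = pairSum N₁ M₁ N₂ M₂ a b α β φ := by
  rw [sum_filter_eq_sum_filter_of_injective
    (s := fun x : (Fin N₁ → Fin (M₁ + 1)) × (Fin N₂ → Fin (M₂ + 1)) =>
      IsRestrictedPair a b α β x.1 x.2)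
    (e := fun x => ((fun i => (x.1 i).castSucc), x.2))]
  · rfl
  · rintro ⟨q, p⟩ ⟨q', p'⟩ h
    simpa [funext_iff] using h
  · simp [isRestrictedPair_castSucc _ _ hxa, Fin.castSucc_ne_last]
  · rintro ⟨q, p⟩ ⟨-, hlast⟩
    exact ⟨(fun i => (q i).castPred (hlast i), p), by simp⟩

theorem pairSum_succ_succ (φ : ℤ → ℤ → A) (ha : 0 ≤ a) (hxa : (N₂ : ℤ) - (N₁ + 1) < a)
    (hxb : -b ≤ (N₂ : ℤ) - (N₁ + 1)) (hy : (M₂ : ℤ) - (M₁ + 1) < β) :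
    pairSum (N₁ + 1) (M₁ + 1) N₂ M₂ a b α β φ =
      pairSum N₁ (M₁ + 1) N₂ M₂ a b α β (fun i j => φ ((M₁ + 1) + i) j)
        + pairSum (N₁ + 1) M₁ N₂ M₂ a b α β φ := by
  classical
  have hlast := sum_filter_last_eq_pairSum (M₁ := M₁ + 1) (α := α) φ ha hxa hxb
    (by push_cast; omega)
  have hne := sum_filter_ne_last_eq_pairSum (M₁ := M₁) (M₂ := M₂) (N₁ := N₁ + 1) (b := b) (α := α)
    (β := β) φ (by push_cast; omega)
  push_cast at hlast
  rw [← hlast, ← hne, pairSum,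
    ← Finset.sum_filter_add_sum_filter_not _ (fun x => x.1 (Fin.last N₁) = Fin.last (M₁ + 1)),
    Finset.filter_filter, Finset.filter_filter]
  congr 1
  refine Finset.sum_congr ?_ fun _ _ => rfl
  ext ⟨q, p⟩
  simp only [Finset.mem_filter_univ]
  refine and_congr_right fun h => ⟨fun h_ne i hi => h_ne ?_, fun h_ne => h_ne _⟩
  exact le_antisymm (Fin.le_last _) (hi ▸ h.monotone_left (Fin.le_last i))

theorem pairSum_succ_zero (φ : ℤ → ℤ → A) (ha : 0 ≤ a) (hxa : (N₂ : ℤ) - (N₁ + 1) < a)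
    (hxb : -b ≤ (N₂ : ℤ) - (N₁ + 1)) (hy : (M₂ : ℤ) < β) :
    pairSum (N₁ + 1) 0 N₂ M₂ a b α β φ = pairSum N₁ 0 N₂ M₂ a b α β φ := by
  classical
  have hlast := sum_filter_last_eq_pairSum (M₁ := 0) (M₂ := M₂) (α := α) (β := β) φ ha hxa hxb
    (by simpa using hy)
  simp only [Nat.cast_zero, zero_add] at hlast
  rw [← hlast, pairSum]
  refine Finset.sum_congr ?_ fun _ _ => rfl
  ext ⟨q, p⟩
  simp only [Finset.mem_filter_univ]
  exact ⟨fun h => ⟨h, Subsingleton.elim (α := Fin 1) _ _⟩, And.left⟩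

theorem pairSum_zero_succ (φ : ℤ → ℤ → A) (hxa : (N₂ : ℤ) < a) :
    pairSum 0 (M₁ + 1) N₂ M₂ a b α β φ = pairSum 0 M₁ N₂ M₂ a b α β φ := by
  classical
  rw [← sum_filter_ne_last_eq_pairSum (N₁ := 0) (M₁ := M₁) φ (by simpa using hxa), pairSum]
  refine Finset.sum_congr ?_ fun _ _ => rfl
  ext ⟨q, p⟩
  simp only [Finset.mem_filter_univ]
  exact ⟨fun h => ⟨h, fun i => i.elim0⟩, And.left⟩

theorem pairSum_eq_zero_of_sub_eq_left (φ : ℤ → ℤ → A)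
    (hx : (N₂ : ℤ) - N₁ = a) (hy : (M₂ : ℤ) - M₁ = -α) :
    pairSum N₁ M₁ N₂ M₂ a b α β φ = 0 := by
  classical
  rw [pairSum, Finset.filter_false_of_mem, Finset.sum_empty]
  rintro ⟨q, p⟩ - h
  have hmax : (M₁ : ℤ) - α + 1 ≤ boxPart p N₂ := h.special_a_max hx.symm
  have hle := boxPart_le p N₂
  omega

theorem pairSum_eq_zero_of_sub_eq_right (φ : ℤ → ℤ → A)
    (hx : (N₂ : ℤ) - N₁ = -b) (hy : (M₂ : ℤ) - M₁ = β) :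
    pairSum N₁ M₁ N₂ M₂ a b α β φ = 0 := by
  rw [pairSum_swap]
  exact pairSum_eq_zero_of_sub_eq_left _ (by omega) (by omega)

theorem pairSum_of_trivial_boxes (φ : ℤ → ℤ → A) (h₁ : N₁ = 0 ∨ M₁ = 0) (h₂ : N₂ = 0 ∨ M₂ = 0)
    (h : IsRestrictedPair a b α β (0 : Fin N₁ → Fin (M₁ + 1)) (0 : Fin N₂ → Fin (M₂ + 1))) :
    pairSum N₁ M₁ N₂ M₂ a b α β φ = φ 0 0 := by
  classical
  have hzero : ∀ {N M : ℕ}, N = 0 ∨ M = 0 → ∀ q : Fin N → Fin (M + 1), q = 0 := by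
    rintro N M (rfl | rfl) q
    · exact Subsingleton.elim _ _
    · exact Subsingleton.elim (α := Fin N → Fin 1) _ _
  rw [pairSum, Finset.sum_eq_single (0, 0)]
  · simp
  · rintro ⟨q, p⟩ - hne
    exact absurd (Prod.ext (hzero h₁ q) (hzero h₂ p)) hne
  · intro hn
    simp [h] at hn

end PairSum

/-- The range of parameters in which the last parts of the two partitions can be removed one at a
time; `x` and `y` are the horizontal and the vertical distance of the endpoints of the two lattice
paths. -/
structure BurgeRange (a b α β x y : ℤ) : Prop where
  a_nonneg : 0 ≤ a
  b_nonneg : 0 ≤ b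
  α_nonneg : 0 ≤ α
  β_nonneg : 0 ≤ β
  a_add_b_pos : 0 < a + b
  α_add_β_pos : 0 < α + β
  x_le : x ≤ a
  neg_le_x : -b ≤ x
  y_le : y ≤ β
  neg_le_y : -α ≤ y

theorem BurgeRange.symm {a b α β x y : ℤ} (h : BurgeRange a b α β x y) :
    BurgeRange b a β α (-x) (-y) := by
  obtain ⟨⟩ := h
  constructor <;> omega

theorem isRestrictedPair_zero_zero {N₂ M₂ : ℕ} {a b α β : ℤ}
    (hα : a ≤ N₂ → 0 < α) (hβ : b ≤ 0 → (M₂ : ℤ) < β) :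
    IsRestrictedPair a b α β (0 : Fin 0 → Fin (0 + 1)) (0 : Fin N₂ → Fin (M₂ + 1)) := by
  have hQ : ∀ i, boxPart (0 : Fin 0 → Fin (0 + 1)) i = 0 := fun i =>
    le_antisymm (by simpa using boxPart_le (0 : Fin 0 → Fin (0 + 1)) i) (boxPart_nonneg _ _)
  have hP := boxPart_le (0 : Fin N₂ → Fin (M₂ + 1)) 1
  have hlast : boxPart (0 : Fin N₂ → Fin (M₂ + 1)) N₂ = 0 := boxPart_zero_of_le le_rfl
  refine isRestrictedPair_iff.2 ⟨fun _ _ _ => le_rfl, fun _ _ _ => le_rfl, ?_⟩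
  constructor <;> intros <;> simp only [hQ, Nat.cast_zero] at * <;> omega

section Conjugation

variable {A : Type*} [AddCommMonoid A] {N₁ M₁ N₂ M₂ : ℕ} {a b α β : ℤ}

/-- Invariance of the sums over restricted partition pairs under reflection of the two lattice
paths in the main diagonal, which is conjugation followed by complementation of both partitions. -/
def Reflects (A : Type*) [AddCommMonoid A] (N₁ M₁ N₂ M₂ : ℕ) (a b α β : ℤ) : Prop :=
  ∀ φ : ℤ → ℤ → A, pairSum N₁ M₁ N₂ M₂ a b α β φ =
    pairSum M₁ N₁ M₂ N₂ β α b a (fun i j => φ (N₁ * M₁ - i) (N₂ * M₂ - j))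

theorem Reflects.symm (h : Reflects A N₁ M₁ N₂ M₂ a b α β) : Reflects A N₂ M₂ N₁ M₁ b a β α := by
  intro φ
  rw [pairSum_swap, h, pairSum_swap]

theorem reflects_of_sub_eq_left (hx : (N₂ : ℤ) - N₁ = a) (hy : (M₂ : ℤ) - M₁ = -α) :
    Reflects A N₁ M₁ N₂ M₂ a b α β := fun φ => by
  rw [pairSum_eq_zero_of_sub_eq_left φ hx hy, pairSum_eq_zero_of_sub_eq_right _ hy hx]

theorem reflects_of_zero_zero (h : N₂ = 0 ∨ M₂ = 0) (hα : a ≤ N₂ → 0 < α)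
    (hβ : b ≤ 0 → (M₂ : ℤ) < β) : Reflects A 0 0 N₂ M₂ a b α β := by
  intro φ
  rw [pairSum_of_trivial_boxes _ (Or.inl rfl) h (isRestrictedPair_zero_zero hα hβ),
    pairSum_of_trivial_boxes _ (Or.inl rfl) h.symm
      (isRestrictedPair_zero_zero (by omega) (by omega))]
  rcases h with rfl | rfl <;> simp

/-- The reflection interchanges the two kinds of last steps of the first path. -/
theorem Reflects.of_pred (h : BurgeRange a b α β (N₂ - N₁) (M₂ - M₁))
    (hxa : (N₂ : ℤ) - N₁ < a) (hyβ : (M₂ : ℤ) - M₁ < β) (hpos : 0 < N₁ + M₁)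
    (hN : 0 < N₁ → Reflects A (N₁ - 1) M₁ N₂ M₂ a b α β)
    (hM : 0 < M₁ → Reflects A N₁ (M₁ - 1) N₂ M₂ a b α β) :
    Reflects A N₁ M₁ N₂ M₂ a b α β := by
  obtain ⟨⟩ := h
  intro φ
  rcases N₁ with _ | N₁ <;> rcases M₁ with _ | M₁
  · omega
  · have hpred := hM (by omega)
    simp only [add_tsub_cancel_right] at hpred
    rw [pairSum_zero_succ φ (by omega), hpred,
      pairSum_succ_zero _ (by omega) (by omega) (by omega) (by omega)]
    simp
  · have hpred := hN (by omega)
    simp only [add_tsub_cancel_right] at hpred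
    rw [pairSum_succ_zero φ (by omega) (by omega) (by omega) (by omega), hpred,
      pairSum_zero_succ _ (by omega)]
    simp
  · have hpredN := hN (by omega)
    have hpredM := hM (by omega)
    simp only [add_tsub_cancel_right] at hpredN hpredM
    rw [pairSum_succ_succ φ (by omega) (by omega) (by omega) (by omega),
      pairSum_succ_succ _ (by omega) (by omega) (by omega) (by omega), hpredN, hpredM, add_comm]
    congr 2 <;> (funext i j; congr 1; push_cast; ring)

theorem reflects_of_burgeRange (h : BurgeRange a b α β (N₂ - N₁) (M₂ - M₁)) :
    Reflects A N₁ M₁ N₂ M₂ a b α β := by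
  induction hn : N₁ + M₁ + N₂ + M₂ using Nat.strong_induction_on
    generalizing N₁ M₁ N₂ M₂ a b α β with
  | _ n ih =>
  have hsymm := h.symm
  rw [neg_sub, neg_sub] at hsymm
  obtain ⟨⟩ := id h
  by_cases hleft : (N₂ : ℤ) - N₁ = a ∧ (M₂ : ℤ) - M₁ = -α
  · exact reflects_of_sub_eq_left hleft.1 hleft.2
  by_cases hright : (N₁ : ℤ) - N₂ = b ∧ (M₁ : ℤ) - M₂ = -β
  · exact (reflects_of_sub_eq_left hright.1 hright.2).symm
  by_cases hQ : 0 < N₁ + M₁ ∧ (N₂ : ℤ) - N₁ < a ∧ (M₂ : ℤ) - M₁ < β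
  · exact .of_pred h hQ.2.1 hQ.2.2 hQ.1
      (fun _ => ih _ (by omega) (by constructor <;> omega) rfl)
      (fun _ => ih _ (by omega) (by constructor <;> omega) rfl)
  by_cases hP : 0 < N₂ + M₂ ∧ (N₁ : ℤ) - N₂ < b ∧ (M₁ : ℤ) - M₂ < α
  · exact (Reflects.of_pred hsymm hP.2.1 hP.2.2 hP.1
      (fun _ => ih _ (by omega) (by constructor <;> omega) rfl)
      (fun _ => ih _ (by omega) (by constructor <;> omega) rfl)).symm
  by_cases hzero : N₁ = 0 ∧ M₁ = 0
  · obtain ⟨rfl, rfl⟩ := hzero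
    exact reflects_of_zero_zero (by omega) (by omega) (by omega)
  · obtain ⟨rfl, rfl⟩ : N₂ = 0 ∧ M₂ = 0 := by omega
    exact (reflects_of_zero_zero (by omega) (by omega) (by omega)).symm

end Conjugation

section Rotation

variable {A : Type*} [AddCommMonoid A] {N M : ℕ} {a b α β : ℤ}

theorem PairCond.rev {N M : ℤ} {Q P : ℤ → ℤ} (h : PairCond N M N M a b α β Q P) :
    PairCond N M N M b a β α (fun i => M - Q (N + 1 - i)) (fun i => M - P (N + 1 - i)) := by
  refine ⟨fun i h₁ h₂ => ?_, fun i h₁ h₂ => ?_, fun hb => ?_, fun ha => ?_, fun hb => ?_,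
    fun ha => ?_⟩
  · have hle := h.right (N - i + b) (by omega) (by omega)
    rw [show N - i + b + 1 - b = N + 1 - i by ring] at hle
    rw [show N + 1 - (i + 1 - b) = N - i + b by ring]
    omega
  · have hle := h.left (N - i + a) (by omega) (by omega)
    rw [show N - i + a + 1 - a = N + 1 - i by ring] at hle
    rw [show N + 1 - (i + 1 - a) = N - i + a by ring]
    omega
  · have hle := h.b_max (by omega)
    rw [show N + 1 - 1 = N by ring]
    omega
  · have hle := h.a_max (by omega)
    rw [show N + 1 - 1 = N by ring]
    omega
  · have hle := h.b_zero (by omega)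
    rw [show N + 1 - N = 1 by ring]
    omega
  · have hle := h.a_zero (by omega)
    rw [show N + 1 - N = 1 by ring]
    omega

theorem IsRestrictedPair.rev {q p : Fin N → Fin (M + 1)} (h : IsRestrictedPair a b α β q p) :
    IsRestrictedPair b a β α (fun j : Fin N => (q j.rev).rev) (fun j : Fin N => (p j.rev).rev) := by
  have hmono : ∀ q : Fin N → Fin (M + 1), Monotone q → Monotone fun j : Fin N => (q j.rev).rev :=
    fun q hq i j hij => Fin.rev_le_rev.2 (hq (Fin.rev_le_rev.2 hij))
  rw [isRestrictedPair_iff] at h ⊢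
  obtain ⟨hq, hp, hcond⟩ := h
  refine ⟨hmono q hq, hmono p hp, ?_⟩
  simpa only [← boxPart_rev] using hcond.rev

theorem sum_rev_rev (q : Fin N → Fin (M + 1)) :
    ∑ i : Fin N, (((q i.rev).rev : ℕ) : ℤ) = N * M - ∑ i, ((q i : ℕ) : ℤ) := by
  have hrev : ∀ i, (((q i).rev : ℕ) : ℤ) = M - ((q i : ℕ) : ℤ) := fun i => by
    rw [Fin.val_rev]
    omega
  calc ∑ i : Fin N, (((q i.rev).rev : ℕ) : ℤ)
      = ∑ i : Fin N, (((q i).rev : ℕ) : ℤ) :=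
        Equiv.sum_comp Fin.revPerm (fun i => (((q i).rev : ℕ) : ℤ))
    _ = N * M - ∑ i, ((q i : ℕ) : ℤ) := by
        simp only [hrev, Finset.sum_sub_distrib, Finset.sum_const, Finset.card_univ,
          Fintype.card_fin, nsmul_eq_mul]

theorem pairSum_rev (φ : ℤ → ℤ → A) :
    pairSum N M N M a b α β φ = pairSum N M N M b a β α (fun i j => φ (N * M - i) (N * M - j)) := by
  classical
  rw [pairSum, sum_filter_eq_sum_filter_of_injective
    (s := fun x : (Fin N → Fin (M + 1)) × (Fin N → Fin (M + 1)) => IsRestrictedPair b a β α x.1 x.2)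
    (e := fun x => (fun j => (x.1 j.rev).rev, fun j => (x.2 j.rev).rev))]
  · simp only [sum_rev_rev]
    rfl
  · exact Function.Involutive.injective fun x => by simp
  · exact fun x => ⟨fun h => by simpa using h.rev, fun h => h.rev⟩
  · exact fun y _ => ⟨(fun j => (y.1 j.rev).rev, fun j => (y.2 j.rev).rev), by simp⟩

theorem pairSum_conj (ha : 0 ≤ a) (hb : 0 ≤ b) (hα : 0 ≤ α) (hβ : 0 ≤ β)
    (hab : 0 < a + b) (hαβ : 0 < α + β) (φ : ℤ → ℤ → A) :
    pairSum N M N M a b α β φ = pairSum M N M N α β a b φ := by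
  rw [reflects_of_burgeRange (by constructor <;> omega), pairSum_rev]
  congr 1
  funext i j
  congr 1 <;> ring

end Rotation

namespace PairCond

variable {N M b β : ℤ} {Q P : ℤ → ℤ}

theorem of_cons (h : PairCond (N + 1) M N M 0 (b + 1) 1 β (fun i => Q (i - 1)) P) (hN : 0 ≤ N)
    (hQ : Q 0 = 0) (hP : P 1 ≤ M) : PairCond N M N M 1 b 1 β Q P := by
  refine ⟨fun i h₁ h₂ => ?_, fun i h₁ h₂ => ?_, by omega, fun hb => ?_, by omega, fun hb => ?_⟩
  · simpa only [sub_zero] using h.left i (by omega) (by omega)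
  · have hle := h.right (i + 1) (by omega) (by omega)
    rwa [add_sub_cancel_right, show i + 1 + 1 - (b + 1) = i + 1 - b by ring] at hle
  · subst hb
    rcases hN.eq_or_lt with rfl | hpos
    · have hmax : M - β + 1 ≤ Q (0 + 1 - 1) := h.b_max (by simp)
      rw [show (0 : ℤ) + 1 - 1 = 0 by ring, hQ] at hmax
      omega
    · have hle := h.right 1 (by omega) (by omega)
      rw [sub_self, hQ, show (1 : ℤ) + 1 - (0 + 1) = 1 by ring] at hle
      omega
  · simpa only [add_sub_cancel_right] using h.b_max (by omega)

theorem cons (h : PairCond N M N M 1 b 1 β Q P) (hb : 0 ≤ b) (hQ : Q 0 = 0) :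
    PairCond (N + 1) M N M 0 (b + 1) 1 β (fun i => Q (i - 1)) P := by
  refine ⟨fun i h₁ h₂ => ?_, fun i h₁ h₂ => ?_, fun _ => ?_, by omega, by omega, fun hmax => ?_⟩
  · simpa only [sub_zero] using h.left i (by omega) (by omega)
  · rcases eq_or_ne i 1 with rfl | hi
    · obtain rfl : b = 0 := by omega
      have hle := h.b_zero rfl
      rw [sub_self, hQ, show (1 : ℤ) + 1 - (0 + 1) = 1 by ring]
      omega
    · have hle := h.right (i - 1) (by omega) (by omega)
      rwa [show i - 1 + 1 - b = i + 1 - (b + 1) by ring] at hle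
  · rw [sub_self, hQ]
  · simpa only [add_sub_cancel_right] using h.b_max (by omega)

theorem eq_zero_of_le {n m : ℕ} (h : PairCond n m n m 1 0 1 1 Q P) (hQ : ∀ i, 0 ≤ Q i)
    (hQ₀ : Q 0 = 0) {i : ℕ} (hi : i ≤ n) : Q i = 0 := by
  induction i with
  | zero => simpa using hQ₀
  | succ i ih =>
    have hP : P (i + 1) ≤ 0 := by
      rcases Nat.eq_zero_or_pos i with rfl | hpos
      · simpa using h.b_zero rfl
      · have hle := h.right i (by omega) (by omega)
        rw [ih (by omega), sub_zero] at hle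
        omega
    have hle := h.left (i + 1) (by omega) (by omega)
    rw [add_sub_cancel_right] at hle
    have hnonneg := hQ (i + 1)
    push_cast
    omega

end PairCond

section RemoveZeroPart

variable {A : Type*} [AddCommMonoid A] {N M : ℕ} {b β : ℤ}

theorem monotone_cons_zero_iff (q : Fin N → Fin (M + 1)) :
    Monotone (Fin.cons 0 q : Fin (N + 1) → Fin (M + 1)) ↔ Monotone q := by
  refine ⟨fun h i j hij => by simpa using h (Fin.succ_le_succ_iff.2 hij), fun h i j => ?_⟩
  cases i using Fin.cases with
  | zero => simp
  | succ i =>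
    cases j using Fin.cases with
    | zero => simp
    | succ j => simpa using @h i j

theorem isRestrictedPair_cons_zero (hb : 0 ≤ b) (q p : Fin N → Fin (M + 1)) :
    IsRestrictedPair 0 (b + 1) 1 β (Fin.cons 0 q : Fin (N + 1) → Fin (M + 1)) p ↔
      IsRestrictedPair 1 b 1 β q p := by
  have hcons : boxPart (Fin.cons 0 q : Fin (N + 1) → Fin (M + 1)) = fun i => boxPart q (i - 1) :=
    funext fun i => by rw [← boxPart_cons_zero q (i - 1), sub_add_cancel]
  have hzero : boxPart q 0 = 0 := boxPart_of_nonpos q le_rfl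
  rw [isRestrictedPair_iff, isRestrictedPair_iff, monotone_cons_zero_iff, hcons, Nat.cast_succ]
  exact and_congr_right fun _ => and_congr_right fun _ =>
    ⟨fun h => h.of_cons (by omega) hzero (boxPart_le p 1), fun h => h.cons hb hzero⟩

theorem pairSum_succ_zero_add_one (hb : 0 ≤ b) (φ : ℤ → ℤ → A) :
    pairSum (N + 1) M N M 0 (b + 1) 1 β φ = pairSum N M N M 1 b 1 β φ := by
  classical
  rw [pairSum, sum_filter_eq_sum_filter_of_injective
    (s := fun x : (Fin N → Fin (M + 1)) × (Fin N → Fin (M + 1)) => IsRestrictedPair 1 b 1 β x.1 x.2)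
    (e := fun x => ((Fin.cons 0 x.1 : Fin (N + 1) → Fin (M + 1)), x.2))]
  · simp only [Fin.sum_univ_succ, Fin.cons_zero, Fin.cons_succ, Fin.val_zero, Nat.cast_zero,
      zero_add]
    rfl
  · rintro ⟨q, p⟩ ⟨q', p'⟩ h
    simpa using h
  · exact fun x => isRestrictedPair_cons_zero hb x.1 x.2
  · rintro ⟨q, p⟩ h
    have hq₀ : q 0 = 0 := by
      have hle := h.special_a_zero rfl
      have hone := boxPart_natCast_add_one q N.succ_pos
      rw [Nat.cast_zero, zero_add] at hone
      rw [hone] at hle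
      exact Fin.ext (show (q 0 : ℕ) = 0 by simpa using hle)
    exact ⟨(Fin.tail q, p), Prod.ext (hq₀ ▸ Fin.cons_self_tail q) rfl⟩

end RemoveZeroPart

section Shift

variable {A : Type*} [AddCommMonoid A] {N M : ℕ} {b β : ℤ}

theorem isRestrictedPair_castSucc_succ (hb : 0 ≤ b) (q p : Fin N → Fin (M + 1)) :
    IsRestrictedPair 1 b 0 β (fun i => (q i).castSucc) (fun i => (p i).succ) ↔
      IsRestrictedPair 1 b 1 (β - 1) q p := by
  have hq : Monotone (fun i => (q i).castSucc) ↔ Monotone q := by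
    simp only [Monotone, Fin.castSucc_le_castSucc_iff]
  have hp : Monotone (fun i => (p i).succ) ↔ Monotone p := by
    simp only [Monotone, Fin.succ_le_succ_iff]
  rw [isRestrictedPair_iff, isRestrictedPair_iff, hq, hp]
  refine and_congr_right fun _ => and_congr_right fun _ => ⟨fun h => ?_, fun h => ?_⟩
  all_goals
    refine ⟨fun i h₁ h₂ => ?_, fun i h₁ h₂ => ?_, by omega, fun hb₀ => ?_, by omega,
      fun hmax => ?_⟩
    · have hle := h.left i h₁ h₂
      rw [boxPart_castSucc _ (by omega), boxPart_succ _ (by omega)] at *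
      omega
    · have hle := h.right i h₁ h₂
      rw [boxPart_castSucc _ (by omega), boxPart_succ _ (by omega)] at *
      omega
    · have hle := h.b_zero hb₀
      rw [boxPart_succ _ (by omega)] at *
      omega
    · have hle := h.b_max hmax
      rw [boxPart_castSucc _ le_rfl] at *
      push_cast at *
      omega

theorem IsRestrictedPair.lt {q p : Fin N → Fin (M + 1)} (h : IsRestrictedPair 1 b 0 β q p)
    (i : Fin N) : q i < p i := by
  have hle := h.ineq_left (((i : ℕ) : ℤ) + 1) (by omega) (by have := i.2; omega)
  rw [add_sub_cancel_right, boxPart_natCast_add_one _ i.2, boxPart_natCast_add_one _ i.2] at hle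
  simp only [Fin.eta] at hle
  exact Fin.lt_def.2 (by omega)

theorem pairSum_succ_zero_right (hb : 0 ≤ b) (φ : ℤ → ℤ → A) :
    pairSum N (M + 1) N (M + 1) 1 b 0 β φ =
      pairSum N M N M 1 b 1 (β - 1) (fun i j => φ i (N + j)) := by
  classical
  rw [pairSum, sum_filter_eq_sum_filter_of_injective
    (s := fun x : (Fin N → Fin (M + 1)) × (Fin N → Fin (M + 1)) =>
      IsRestrictedPair 1 b 1 (β - 1) x.1 x.2)
    (e := fun x => ((fun i => (x.1 i).castSucc), (fun i => (x.2 i).succ)))]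
  · refine Finset.sum_congr rfl fun x _ => ?_
    simp [Finset.sum_add_distrib, add_comm]
  · rintro ⟨q, p⟩ ⟨q', p'⟩ h
    simpa [funext_iff] using h
  · exact fun x => isRestrictedPair_castSucc_succ hb x.1 x.2
  · rintro ⟨q, p⟩ h
    have hq : ∀ i, q i ≠ Fin.last (M + 1) := fun i => ((h.lt i).trans_le (Fin.le_last _)).ne
    have hp : ∀ i, p i ≠ 0 := fun i => ((Fin.zero_le _).trans_lt (h.lt i)).ne'
    exact ⟨(fun i => (q i).castPred (hq i), fun i => (p i).pred (hp i)), by simp⟩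

end Shift

section Terminal

variable {A : Type*} [AddCommMonoid A] {N M : ℕ}

theorem pairSum_box_zero_right {b β : ℤ} (hβ : b ≤ 0 → 0 < β) (φ : ℤ → ℤ → A) :
    pairSum N 0 N 0 1 b 0 β φ = if N = 0 then φ 0 0 else 0 := by
  classical
  rcases Nat.eq_zero_or_pos N with rfl | hN
  · rw [if_pos rfl, pairSum_of_trivial_boxes _ (Or.inl rfl) (Or.inl rfl)]
    exact isRestrictedPair_zero_zero (by simp) (by simpa using hβ)
  · rw [if_neg hN.ne', pairSum, Finset.filter_false_of_mem, Finset.sum_empty]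
    rintro ⟨q, p⟩ - h
    exact (h.lt ⟨0, hN⟩).ne (Subsingleton.elim (α := Fin 1) _ _)

theorem pairSum_one_zero_one_one (φ : ℤ → ℤ → A) :
    pairSum N M N M 1 0 1 1 φ = if M = 0 then φ 0 0 else 0 := by
  classical
  rcases Nat.eq_zero_or_pos M with rfl | hM
  · have hzero : ∀ i, boxPart (0 : Fin N → Fin (0 + 1)) i = 0 := fun i =>
      le_antisymm (by simpa using boxPart_le (0 : Fin N → Fin (0 + 1)) i) (boxPart_nonneg _ _)
    rw [if_pos rfl, pairSum_of_trivial_boxes _ (Or.inr rfl) (Or.inr rfl)]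
    refine isRestrictedPair_iff.2 ⟨fun _ _ _ => le_rfl, fun _ _ _ => le_rfl, ?_⟩
    constructor <;> simp [hzero]
  · rw [if_neg hM.ne', pairSum, Finset.filter_false_of_mem, Finset.sum_empty]
    rintro ⟨q, p⟩ - h
    have hmax := h.special_b_max (by omega)
    have hzero := (isRestrictedPair_iff.1 h).2.2.eq_zero_of_le (boxPart_nonneg q)
      (boxPart_of_nonpos q le_rfl) (le_refl N)
    rw [hzero] at hmax
    omega

end Terminal

section Gauss

open PowerSeries

theorem qFact_succ (n : ℕ) : qFact (n + 1) = qFact n * (1 - X ^ (n + 1)) :=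
  Finset.prod_range_succ _ _

theorem qFact_zero : qFact 0 = 1 := rfl

theorem invQFact_mul_qFact (n : ℕ) : invQFact n * qFact n = 1 := by
  rw [mul_comm, qFact_mul_invQFact]

theorem invQFact_eq_invQFact_succ_mul (n : ℕ) :
    invQFact n = invQFact (n + 1) * (1 - X ^ (n + 1)) := by
  calc invQFact n = invQFact n * (qFact (n + 1) * invQFact (n + 1)) := by
        rw [qFact_mul_invQFact, mul_one]
    _ = invQFact n * qFact n * (invQFact (n + 1) * (1 - X ^ (n + 1))) := by
        rw [qFact_succ]; ring
    _ = invQFact (n + 1) * (1 - X ^ (n + 1)) := by rw [invQFact_mul_qFact, one_mul]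

theorem invQFact_zero : invQFact 0 = 1 := by
  simpa only [qFact_zero, one_mul] using qFact_mul_invQFact 0

theorem gauss_natCast_add (m k : ℕ) :
    gauss ((m : ℤ) + k) k = qFact (m + k) * invQFact k * invQFact m := by
  rw [gauss, if_pos (by omega)]
  congr 2
  omega

theorem gauss_self (k : ℕ) : gauss (k : ℤ) k = 1 := by
  simpa [invQFact_zero, qFact_mul_invQFact] using gauss_natCast_add 0 k

theorem gauss_zero_right (m : ℕ) : gauss (m : ℤ) 0 = 1 := by
  simpa [invQFact_zero, qFact_mul_invQFact] using gauss_natCast_add m 0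

theorem gauss_of_neg {m k : ℤ} (hk : k < 0) : gauss m k = 0 :=
  if_neg (by omega)

theorem gauss_of_lt {m k : ℤ} (h : m < k) : gauss m k = 0 :=
  if_neg (by omega)

theorem gauss_pascal {m : ℤ} (hm : 0 ≤ m) (k : ℕ) (h : 0 < m + k) :
    gauss (m + k) k = gauss (m - 1 + k) k + X ^ m.toNat * gauss (m + k - 1) (k - 1) := by
  lift m to ℕ using hm
  simp only [Int.toNat_natCast]
  rcases m with _ | m <;> rcases k with _ | k
  · simp at h
  · rw [Nat.cast_zero, zero_add, pow_zero, one_mul, gauss_self, gauss_of_lt (by omega), zero_add,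
      Nat.cast_succ, add_sub_cancel_right, gauss_self]
  · rw [Nat.cast_zero, gauss_of_neg (k := 0 - 1) (by omega), mul_zero, add_zero, add_zero, add_zero,
      gauss_zero_right, Nat.cast_succ, add_sub_cancel_right, gauss_zero_right]
  · rw [gauss_natCast_add,
      show ((m + 1 : ℕ) : ℤ) - 1 + (k + 1 : ℕ) = (m : ℤ) + (k + 1 : ℕ) by push_cast; ring,
      show ((m + 1 : ℕ) : ℤ) + (k + 1 : ℕ) - 1 = ((m + 1 : ℕ) : ℤ) + k by push_cast; ring,
      show ((k + 1 : ℕ) : ℤ) - 1 = k by push_cast; ring, gauss_natCast_add, gauss_natCast_add,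
      show m + 1 + (k + 1) = m + k + 1 + 1 by ring, show m + (k + 1) = m + k + 1 by ring,
      show m + 1 + k = m + k + 1 by ring, qFact_succ (m + k + 1),
      invQFact_eq_invQFact_succ_mul m, invQFact_eq_invQFact_succ_mul k]
    ring

end Gauss

section PairGF

open PowerSeries

variable {N₁ M₁ N₂ M₂ : ℕ} {a b α β : ℤ}

/-- The generating function `R(N₁, M₁, N₂, M₂, a, b, α, β)` as a power series. -/
noncomputable def pairGF (N₁ M₁ N₂ M₂ : ℕ) (a b α β : ℤ) : PowerSeries ℤ :=
  pairSum N₁ M₁ N₂ M₂ a b α β (fun i j => X ^ (i + j).toNat)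

theorem coe_genFun (N₁ M₁ N₂ M₂ : ℕ) (a b α β : ℤ) :
    (genFun N₁ M₁ N₂ M₂ a b α β : PowerSeries ℤ) = pairGF N₁ M₁ N₂ M₂ a b α β := by
  rw [genFun, pairGF, pairSum, ← Polynomial.coeToPowerSeries.ringHom_apply, map_sum]
  refine Finset.sum_congr rfl fun x _ => ?_
  rw [map_pow, Polynomial.coeToPowerSeries.ringHom_apply, Polynomial.coe_X]
  norm_cast

theorem pairSum_X_pow (n : ℕ) {φ : ℤ → ℤ → ℤ} (hφ : ∀ i j, φ i j = n + (i + j)) :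
    pairSum N₁ M₁ N₂ M₂ a b α β (fun i j => (X : PowerSeries ℤ) ^ (φ i j).toNat) =
      X ^ n * pairGF N₁ M₁ N₂ M₂ a b α β := by
  rw [pairGF, pairSum, pairSum, Finset.mul_sum]
  refine Finset.sum_congr rfl fun x _ => ?_
  rw [hφ, ← pow_add]
  congr 1
  have hq : 0 ≤ ∑ i, ((x.1 i : ℕ) : ℤ) := Finset.sum_nonneg fun i _ => by positivity
  have hp : 0 ≤ ∑ i, ((x.2 i : ℕ) : ℤ) := Finset.sum_nonneg fun i _ => by positivity
  omega

theorem pairGF_swap : pairGF N₁ M₁ N₂ M₂ a b α β = pairGF N₂ M₂ N₁ M₁ b a β α := by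
  rw [pairGF, pairSum_swap]
  simp only [add_comm]
  rfl

theorem pairGF_succ_succ (ha : 0 ≤ a) (hxa : (N₂ : ℤ) - (N₁ + 1) < a)
    (hxb : -b ≤ (N₂ : ℤ) - (N₁ + 1)) (hy : (M₂ : ℤ) - (M₁ + 1) < β) :
    pairGF (N₁ + 1) (M₁ + 1) N₂ M₂ a b α β =
      X ^ (M₁ + 1) * pairGF N₁ (M₁ + 1) N₂ M₂ a b α β + pairGF (N₁ + 1) M₁ N₂ M₂ a b α β := by
  rw [pairGF, pairSum_succ_succ _ ha hxa hxb hy,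
    pairSum_X_pow (M₁ + 1) fun i j => by push_cast; ring]
  rfl

theorem isRestrictedPair_iff_monotone_of_lt (hα : M₁ < α) (hβ : M₂ < β)
    (q : Fin N₁ → Fin (M₁ + 1)) (p : Fin N₂ → Fin (M₂ + 1)) :
    IsRestrictedPair a b α β q p ↔ Monotone q ∧ Monotone p := by
  refine ⟨fun h => ⟨h.1, h.2⟩, fun h => ⟨h.1, h.2, fun i _ _ => ?_, fun i _ _ => ?_, fun _ => ?_,
    fun _ => ?_, fun _ => ?_, fun _ => ?_⟩⟩
  · linarith [boxPart_nonneg p i, boxPart_le q (i + 1 - a)]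
  · linarith [boxPart_nonneg q i, boxPart_le p (i + 1 - b)]
  · linarith [boxPart_le q 1]
  · linarith [boxPart_le p 1]
  · linarith [boxPart_nonneg p N₂]
  · linarith [boxPart_nonneg q N₁]

theorem pairGF_eq_pairGF_of_lt {a' b' α' β' : ℤ} (hα : M₁ < α) (hβ : M₂ < β) (hα' : M₁ < α')
    (hβ' : M₂ < β') : pairGF N₁ M₁ N₂ M₂ a b α β = pairGF N₁ M₁ N₂ M₂ a' b' α' β' := by
  simp only [pairGF, pairSum, isRestrictedPair_iff_monotone_of_lt hα hβ,
    isRestrictedPair_iff_monotone_of_lt hα' hβ']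

end PairGF

section PairGFInt

open PowerSeries

variable {a b α β N₁ M₁ N₂ M₂ : ℤ}

/-- The generating function `pairGF` for integral sizes of the boxes, where it is zero if one of
the sizes is negative; this convention makes the recurrences hold without exceptions at the
boundary. -/
noncomputable def pairGFInt (a b α β N₁ M₁ N₂ M₂ : ℤ) : PowerSeries ℤ :=
  if 0 ≤ N₁ ∧ 0 ≤ M₁ ∧ 0 ≤ N₂ ∧ 0 ≤ M₂ then
    pairGF N₁.toNat M₁.toNat N₂.toNat M₂.toNat a b α β else 0

theorem pairGFInt_swap :
    pairGFInt a b α β N₁ M₁ N₂ M₂ = pairGFInt b a β α N₂ M₂ N₁ M₁ := by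
  unfold pairGFInt
  by_cases h : 0 ≤ N₁ ∧ 0 ≤ M₁ ∧ 0 ≤ N₂ ∧ 0 ≤ M₂
  · rw [if_pos h, if_pos (by omega), pairGF_swap]
  · rw [if_neg h, if_neg (by omega)]

theorem pairGFInt_of_neg (h : N₁ < 0 ∨ M₁ < 0 ∨ N₂ < 0 ∨ M₂ < 0) :
    pairGFInt a b α β N₁ M₁ N₂ M₂ = 0 :=
  if_neg (by omega)

theorem pairGFInt_natCast (a b α β : ℤ) (N₁ M₁ N₂ M₂ : ℕ) :
    pairGFInt a b α β N₁ M₁ N₂ M₂ = pairGF N₁ M₁ N₂ M₂ a b α β := by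
  rw [pairGFInt, if_pos (by omega)]
  simp only [Int.toNat_natCast]

theorem pairGFInt_eq_zero_of_sub_eq_left (hx : N₂ - N₁ = a) (hy : M₂ - M₁ = -α) :
    pairGFInt a b α β N₁ M₁ N₂ M₂ = 0 := by
  unfold pairGFInt
  split_ifs with h
  · exact pairSum_eq_zero_of_sub_eq_left _ (by omega) (by omega)
  · rfl

theorem pairGFInt_zero_zero (h : N₂ = 0 ∨ M₂ = 0) (hN₂ : 0 ≤ N₂) (hM₂ : 0 ≤ M₂)
    (hα : a ≤ N₂ → 0 < α) (hβ : b ≤ 0 → M₂ < β) :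
    pairGFInt a b α β 0 0 N₂ M₂ = 1 := by
  lift N₂ to ℕ using hN₂
  lift M₂ to ℕ using hM₂
  rw [← Nat.cast_zero, pairGFInt_natCast, pairGF, pairSum_of_trivial_boxes _ (Or.inl rfl)
    (by omega) (isRestrictedPair_zero_zero hα hβ), add_zero, Int.toNat_zero, pow_zero]

theorem pairGFInt_eq_add (ha : 0 ≤ a) (hxa : N₂ - N₁ < a) (hxb : -b ≤ N₂ - N₁)
    (hy : M₂ - M₁ < β) (hpos : N₁ + M₁ ≠ 0) :
    pairGFInt a b α β N₁ M₁ N₂ M₂ =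
      X ^ M₁.toNat * pairGFInt a b α β (N₁ - 1) M₁ N₂ M₂
        + pairGFInt a b α β N₁ (M₁ - 1) N₂ M₂ := by
  by_cases h : 0 ≤ N₁ ∧ 0 ≤ M₁ ∧ 0 ≤ N₂ ∧ 0 ≤ M₂
  · obtain ⟨hN₁, hM₁, hN₂, hM₂⟩ := h
    lift N₁ to ℕ using hN₁
    lift M₁ to ℕ using hM₁
    lift N₂ to ℕ using hN₂
    lift M₂ to ℕ using hM₂
    have hpred : ∀ n : ℕ, ((n + 1 : ℕ) : ℤ) - 1 = n := fun n => by push_cast; ring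
    rcases N₁ with _ | N₁ <;> rcases M₁ with _ | M₁
    · simp at hpos
    · rw [pairGFInt_of_neg (N₁ := ((0 : ℕ) : ℤ) - 1) (by omega), mul_zero, zero_add, hpred,
        pairGFInt_natCast, pairGFInt_natCast]
      exact pairSum_zero_succ _ (by omega)
    · rw [pairGFInt_of_neg (M₁ := ((0 : ℕ) : ℤ) - 1) (by omega), add_zero, hpred,
        pairGFInt_natCast, pairGFInt_natCast, Int.toNat_natCast, pow_zero, one_mul]
      exact pairSum_succ_zero _ ha (by omega) (by omega) (by omega)
    · rw [hpred, hpred, pairGFInt_natCast, pairGFInt_natCast, pairGFInt_natCast,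
        Int.toNat_natCast]
      exact pairGF_succ_succ ha (by omega) (by omega) (by omega)
  · rw [pairGFInt_of_neg (by omega), pairGFInt_of_neg (by omega), pairGFInt_of_neg (by omega),
      mul_zero, add_zero]

theorem pairGFInt_eq_gauss (hN₂ : 0 ≤ N₂) (ha : N₂ < a) (hb : N₁ - N₂ ≤ b) (hβ : 0 < β) :
    pairGFInt a b α β N₁ M₁ N₂ 0 = gauss (M₁ + N₁) N₁ := by
  induction hn : (N₁ + M₁).toNat using Nat.strong_induction_on generalizing N₁ M₁ with
  | _ n ih =>
  by_cases hneg : N₁ < 0 ∨ M₁ < 0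
  · rw [pairGFInt_of_neg (by omega), gauss, if_neg (by omega)]
  rcases eq_or_ne (N₁ + M₁) 0 with hzero | hpos
  · obtain ⟨rfl, rfl⟩ : N₁ = 0 ∧ M₁ = 0 := by omega
    rw [pairGFInt_zero_zero (Or.inr rfl) hN₂ le_rfl (by omega) (fun _ => hβ)]
    exact (gauss_self 0).symm
  · lift N₁ to ℕ using by omega
    rw [pairGFInt_eq_add (by omega) (by omega) (by omega) (by omega) hpos,
      gauss_pascal (by omega) _ (by omega), ih _ (by omega) (by omega) rfl,
      ih _ (by omega) (by omega) rfl, add_comm, add_sub_assoc]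

theorem pairGFInt_eq_gauss_of_lt (hN₁ : 0 ≤ N₁) (hM₁ : 0 ≤ M₁) (hN₂ : 0 ≤ N₂) (hα : M₁ < α)
    (hβ : 0 < β) : pairGFInt a b α β N₁ M₁ N₂ 0 = gauss (M₁ + N₁) N₁ := by
  rw [← pairGFInt_eq_gauss (a := N₂ + 1) (b := N₁) (α := α) hN₂ (by omega) (by omega) hβ]
  lift N₁ to ℕ using hN₁
  lift M₁ to ℕ using hM₁
  lift N₂ to ℕ using hN₂
  rw [← Nat.cast_zero, pairGFInt_natCast, pairGFInt_natCast,
    pairGF_eq_pairGF_of_lt hα (by omega) hα (by omega)]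

end PairGFInt

section BurgeSum

open PowerSeries

variable {a b α β N₁ M₁ N₂ M₂ : ℤ} {k K : ℕ}

/-- The summand of the Burge transform in which the two partitions have lost `k` parts each. -/
noncomputable def burgeTerm (a b α β N₁ M₁ N₂ M₂ : ℤ) (k : ℕ) : PowerSeries ℤ :=
  X ^ ((N₁ - k) * (N₂ - k)).toNat * gauss (M₁ + M₂ + k) k *
    pairGFInt a b α β (N₁ - k) (M₁ - N₂ + k) (N₂ - k) (M₂ - N₁ + k)

theorem burgeTerm_swap :
    burgeTerm a b α β N₁ M₁ N₂ M₂ k = burgeTerm b a β α N₂ M₂ N₁ M₁ k := by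
  unfold burgeTerm
  rw [pairGFInt_swap, mul_comm (N₁ - (k : ℤ)), add_comm M₁ M₂]

theorem burgeTerm_of_neg (h : N₁ < k ∨ N₂ < k ∨ M₁ + k < N₂ ∨ M₂ + k < N₁) :
    burgeTerm a b α β N₁ M₁ N₂ M₂ k = 0 := by
  unfold burgeTerm
  rw [pairGFInt_of_neg (by omega), mul_zero]

theorem burgeTerm_eq_zero_of_sub_eq_left (hx : N₂ - N₁ = a) (hy : N₂ - N₁ + (M₂ - M₁) = -α) :
    burgeTerm a b α β N₁ M₁ N₂ M₂ k = 0 := by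
  unfold burgeTerm
  rw [pairGFInt_eq_zero_of_sub_eq_left (by omega) (by omega), mul_zero]

/-- The Burge transform of the generating function of restricted partition pairs, with the
summation over `k < K`; all further summands vanish if `K` exceeds `N₁` or `N₂`. -/
noncomputable def burgeSum (K : ℕ) (a b α β N₁ M₁ N₂ M₂ : ℤ) : PowerSeries ℤ :=
  ∑ k ∈ Finset.range K, burgeTerm a b α β N₁ M₁ N₂ M₂ k

theorem burgeSum_swap :
    burgeSum K a b α β N₁ M₁ N₂ M₂ = burgeSum K b a β α N₂ M₂ N₁ M₁ :=
  Finset.sum_congr rfl fun _ _ => burgeTerm_swap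

theorem burgeSum_of_neg (h : N₁ < 0 ∨ M₁ < 0 ∨ N₂ < 0 ∨ M₂ < 0) :
    burgeSum K a b α β N₁ M₁ N₂ M₂ = 0 :=
  Finset.sum_eq_zero fun k _ => burgeTerm_of_neg (by omega)

/-- The contribution to `burgeTerm` of the pairs in which the largest part of the first partition
has the maximal size `M₁ - N₂ + k`. -/
noncomputable def burgeTermMaxPart (a b α β N₁ M₁ N₂ M₂ : ℤ) (k : ℕ) : PowerSeries ℤ :=
  X ^ ((N₁ - k) * (N₂ - k)).toNat * gauss (M₁ + M₂ + k) k *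
    (X ^ (M₁ - N₂ + k).toNat *
      pairGFInt a b α β (N₁ - k - 1) (M₁ - N₂ + k) (N₂ - k) (M₂ - N₁ + k))

/-- The contribution to `burgeTerm` of the remaining pairs and of the second summand in Pascal's
rule for the Gaussian polynomial. -/
noncomputable def burgeTermPascal (a b α β N₁ M₁ N₂ M₂ : ℤ) (k : ℕ) : PowerSeries ℤ :=
  X ^ ((N₁ - k) * (N₂ - k)).toNat * (X ^ (M₁ + M₂).toNat * gauss (M₁ + M₂ + k - 1) (k - 1)) *
    pairGFInt a b α β (N₁ - k) (M₁ - N₂ + k - 1) (N₂ - k) (M₂ - N₁ + k)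

theorem burgeTerm_eq_add (h : BurgeRange a b α β (N₂ - N₁) (N₂ - N₁ + (M₂ - M₁)))
    (hx : N₂ - N₁ < a) (hy : N₂ - N₁ + (M₂ - M₁) < β) (h₁ : N₂ < N₁ + M₁) (h₂ : N₁ ≤ N₂ + M₂) :
    burgeTerm a b α β N₁ M₁ N₂ M₂ k =
      burgeTermMaxPart a b α β N₁ M₁ N₂ M₂ k + burgeTermPascal a b α β N₁ M₁ N₂ M₂ k
        + burgeTerm a b α β N₁ (M₁ - 1) N₂ M₂ k := by
  obtain ⟨⟩ := h
  unfold burgeTerm burgeTermMaxPart burgeTermPascal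
  rw [pairGFInt_eq_add (by omega) (by omega) (by omega) (by omega) (by omega),
    gauss_pascal (by omega) k (by omega),
    show M₁ - 1 + M₂ + (k : ℤ) = M₁ + M₂ - 1 + k by ring,
    show M₁ - 1 - N₂ + (k : ℤ) = M₁ - N₂ + k - 1 by ring]
  ring

theorem X_pow_mul_burgeTerm_left (hM₁ : 0 ≤ M₁) :
    X ^ M₁.toNat * (X ^ ((N₁ - 1 - k) * (N₂ - k)).toNat * gauss (M₁ + M₂ + k) k *
        pairGFInt a b α β (N₁ - 1 - k) (M₁ - N₂ + k) (N₂ - k) (M₂ - (N₁ - 1) + k - 1)) =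
      burgeTermMaxPart a b α β N₁ M₁ N₂ M₂ k := by
  unfold burgeTermMaxPart
  rw [show N₁ - 1 - (k : ℤ) = N₁ - k - 1 by ring,
    show M₂ - (N₁ - 1) + (k : ℤ) - 1 = M₂ - N₁ + k by ring]
  by_cases h : 0 ≤ N₁ - k - 1 ∧ 0 ≤ N₂ - k ∧ 0 ≤ M₁ - N₂ + k
  · obtain ⟨hn₁, hn₂, hm₁⟩ := h
    have exponent : M₁.toNat + ((N₁ - k - 1) * (N₂ - k)).toNat =
        ((N₁ - k) * (N₂ - k)).toNat + (M₁ - N₂ + k).toNat := by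
      zify
      rw [Int.toNat_of_nonneg (mul_nonneg hn₁ hn₂), Int.toNat_of_nonneg hM₁,
        Int.toNat_of_nonneg (mul_nonneg (by omega) hn₂), Int.toNat_of_nonneg hm₁]
      ring
    linear_combination (norm := (simp only [pow_add]; ring))
      gauss (M₁ + M₂ + k) k *
        pairGFInt a b α β (N₁ - k - 1) (M₁ - N₂ + k) (N₂ - k) (M₂ - N₁ + k) *
        congrArg (fun e => (X : PowerSeries ℤ) ^ e) exponent
  · rw [pairGFInt_of_neg (by omega)]
    simp only [mul_zero]

theorem X_pow_mul_burgeTerm_right (hM₁ : 0 ≤ M₁) (hM₂ : 0 ≤ M₂) :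
    X ^ M₁.toNat * (X ^ ((N₁ - 1 - k) * (N₂ - k)).toNat * gauss (M₁ + M₂ + k) k *
        (X ^ (M₂ - (N₁ - 1) + k).toNat *
          pairGFInt a b α β (N₁ - 1 - k) (M₁ - N₂ + k) (N₂ - k - 1) (M₂ - (N₁ - 1) + k))) =
      burgeTermPascal a b α β N₁ M₁ N₂ M₂ (k + 1) := by
  unfold burgeTermPascal
  push_cast
  rw [show N₁ - 1 - (k : ℤ) = N₁ - (k + 1) by ring,
    show M₂ - (N₁ - 1) + (k : ℤ) = M₂ - N₁ + (k + 1) by ring,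
    show N₂ - (k : ℤ) - 1 = N₂ - (k + 1) by ring,
    show M₁ - N₂ + ((k : ℤ) + 1) - 1 = M₁ - N₂ + k by ring,
    show M₁ + M₂ + ((k : ℤ) + 1) - 1 = M₁ + M₂ + k by ring, add_sub_cancel_right]
  by_cases h : 0 ≤ N₁ - (k + 1) ∧ 0 ≤ N₂ - (k + 1) ∧ 0 ≤ M₂ - N₁ + (k + 1)
  · obtain ⟨hn₁, hn₂, hm₂⟩ := h
    have exponent : M₁.toNat + ((N₁ - (k + 1)) * (N₂ - k)).toNat + (M₂ - N₁ + (k + 1)).toNat =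
        ((N₁ - (k + 1)) * (N₂ - (k + 1))).toNat + (M₁ + M₂).toNat := by
      zify
      rw [Int.toNat_of_nonneg (mul_nonneg hn₁ hn₂), Int.toNat_of_nonneg hM₁,
        Int.toNat_of_nonneg (mul_nonneg hn₁ (by omega)), Int.toNat_of_nonneg hm₂,
        Int.toNat_of_nonneg (add_nonneg hM₁ hM₂)]
      ring
    linear_combination (norm := (simp only [pow_add]; ring))
      gauss (M₁ + M₂ + k) k *
        pairGFInt a b α β (N₁ - (k + 1)) (M₁ - N₂ + k) (N₂ - (k + 1)) (M₂ - N₁ + (k + 1)) *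
        congrArg (fun e => (X : PowerSeries ℤ) ^ e) exponent
  · rw [pairGFInt_of_neg (by omega)]
    simp only [mul_zero]

theorem X_pow_mul_burgeTerm (h : BurgeRange a b α β (N₂ - N₁) (N₂ - N₁ + (M₂ - M₁)))
    (hx : N₂ - N₁ < a) (hM₁ : 0 ≤ M₁) (hM₂ : 0 ≤ M₂) (h₂ : N₁ ≤ N₂ + M₂) :
    X ^ M₁.toNat * burgeTerm a b α β (N₁ - 1) M₁ N₂ M₂ k =
      burgeTermMaxPart a b α β N₁ M₁ N₂ M₂ k + burgeTermPascal a b α β N₁ M₁ N₂ M₂ (k + 1) := by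
  obtain ⟨⟩ := h
  unfold burgeTerm
  rw [pairGFInt_swap, pairGFInt_eq_add (by omega) (by omega) (by omega) (by omega) (by omega),
    pairGFInt_swap, pairGFInt_swap (a := b), mul_add, mul_add, X_pow_mul_burgeTerm_left hM₁,
    X_pow_mul_burgeTerm_right hM₁ hM₂, add_comm]

theorem sum_burgeTermPascal_succ (hK : N₁ < K) :
    ∑ k ∈ Finset.range K, burgeTermPascal a b α β N₁ M₁ N₂ M₂ (k + 1) =
      ∑ k ∈ Finset.range K, burgeTermPascal a b α β N₁ M₁ N₂ M₂ k := by
  have first : burgeTermPascal a b α β N₁ M₁ N₂ M₂ 0 = 0 := by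
    rw [burgeTermPascal, gauss_of_neg (k := ((0 : ℕ) : ℤ) - 1) (by omega), mul_zero, mul_zero,
      zero_mul]
  have last : burgeTermPascal a b α β N₁ M₁ N₂ M₂ K = 0 := by
    rw [burgeTermPascal, pairGFInt_of_neg (by omega), mul_zero]
  rw [← add_zero (∑ k ∈ _, _), ← first, ← Finset.sum_range_succ', Finset.sum_range_succ, last,
    add_zero]

theorem burgeSum_eq_add (h : BurgeRange a b α β (N₂ - N₁) (N₂ - N₁ + (M₂ - M₁)))
    (hx : N₂ - N₁ < a) (hy : N₂ - N₁ + (M₂ - M₁) < β) (hM₁ : 0 ≤ M₁) (hM₂ : 0 ≤ M₂)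
    (h₁ : N₂ < N₁ + M₁) (h₂ : N₁ ≤ N₂ + M₂) (hK : N₁ < K) :
    burgeSum K a b α β N₁ M₁ N₂ M₂ =
      X ^ M₁.toNat * burgeSum K a b α β (N₁ - 1) M₁ N₂ M₂
        + burgeSum K a b α β N₁ (M₁ - 1) N₂ M₂ := by
  simp only [burgeSum, Finset.mul_sum, burgeTerm_eq_add h hx hy h₁ h₂,
    X_pow_mul_burgeTerm h hx hM₁ hM₂ h₂, Finset.sum_add_distrib, sum_burgeTermPascal_succ hK]

end BurgeSum

section BurgeTransform

open PowerSeries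

variable {a b α β : ℤ} {K : ℕ}

theorem burge_transform_of_height_zero {N M : ℤ} (ha : 0 ≤ a) (hb : 0 ≤ b) (hN : 0 ≤ N)
    (hM : 0 ≤ M) (hα : M < α + a) (hβ : 0 < β + b) (hK : N < K) :
    pairGFInt a b (α + a) (β + b) N M N 0 = burgeSum K a b α β N M N 0 := by
  rw [pairGFInt_eq_gauss_of_lt hN hM hN hα hβ]
  lift N to ℕ using hN
  rw [burgeSum, Finset.sum_eq_single N (fun k _ hk => burgeTerm_of_neg (by omega))
    (fun hNK => absurd (Finset.mem_range.2 (by omega)) hNK), burgeTerm, sub_self, mul_zero,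
    Int.toNat_zero, pow_zero, one_mul, add_zero, sub_add_cancel, zero_sub, neg_add_cancel,
    pairGFInt_swap,
    pairGFInt_zero_zero (Or.inl rfl) le_rfl hM (by omega) (by omega), mul_one]

theorem burge_transform_of_width_eq {N M : ℤ} (ha : 0 ≤ a) (hN : 0 ≤ N) (hM : 0 ≤ M)
    (hα : 0 < α + a) (hβ : M < β + b) (hK : N < K) :
    pairGFInt a b (α + a) (β + b) (N + M) 0 N M = burgeSum K a b α β (N + M) 0 N M := by
  rw [pairGFInt_swap, pairGFInt_eq_gauss_of_lt hN hM (by omega) hβ hα]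
  lift N to ℕ using hN
  rw [burgeSum, Finset.sum_eq_single N (fun k _ hk => burgeTerm_of_neg (by omega))
    (fun hNK => absurd (Finset.mem_range.2 (by omega)) hNK), burgeTerm, sub_self, mul_zero,
    Int.toNat_zero, pow_zero, one_mul, zero_add, zero_sub, neg_add_cancel, add_sub_cancel_left,
    show M - (N + M) + (N : ℤ) = 0 by ring, pairGFInt_swap,
    pairGFInt_zero_zero (Or.inr rfl) hM le_rfl (by omega) (by omega), mul_one]

variable {N₁ M₁ N₂ M₂ : ℤ}

theorem burge_transform_of_sub_eq_left (hx : N₂ - N₁ = a) (hy : N₂ - N₁ + (M₂ - M₁) = -α) :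
    pairGFInt a b (α + a) (β + b) N₁ M₁ N₂ M₂ = burgeSum K a b α β N₁ M₁ N₂ M₂ := by
  rw [pairGFInt_eq_zero_of_sub_eq_left (by omega) (by omega)]
  exact (Finset.sum_eq_zero fun k _ => burgeTerm_eq_zero_of_sub_eq_left hx hy).symm

theorem burge_transform_of_neg (h : N₁ < 0 ∨ M₁ < 0 ∨ N₂ < 0 ∨ M₂ < 0) :
    pairGFInt a b (α + a) (β + b) N₁ M₁ N₂ M₂ = burgeSum K a b α β N₁ M₁ N₂ M₂ := by
  rw [pairGFInt_of_neg h, burgeSum_of_neg h]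

theorem burge_transform_of_eq_add (h : BurgeRange a b α β (N₂ - N₁) (N₂ - N₁ + (M₂ - M₁)))
    (hM₁ : 0 ≤ M₁) (hN₂ : 0 ≤ N₂) (hM₂ : 0 ≤ M₂) (h₁ : N₂ ≤ N₁ + M₁) (h₂ : N₁ = N₂ + M₂)
    (hleft : ¬(N₂ - N₁ = a ∧ N₂ - N₁ + (M₂ - M₁) = -α))
    (hright : ¬(N₂ - N₁ = -b ∧ N₂ - N₁ + (M₂ - M₁) = β))
    (hstep : N₂ - N₁ = a ∨ N₂ - N₁ + (M₂ - M₁) = β ∨ N₂ = N₁ + M₁) (hK : N₂ < K) :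
    pairGFInt a b (α + a) (β + b) N₁ M₁ N₂ M₂ = burgeSum K a b α β N₁ M₁ N₂ M₂ := by
  obtain ⟨⟩ := h
  subst h₂
  rcases hM₂.eq_or_lt with rfl | hM₂_pos
  · simp only [add_zero]
    exact burge_transform_of_height_zero (by omega) (by omega) hN₂ hM₁ (by omega) (by omega) hK
  · obtain rfl : M₁ = 0 := by omega
    exact burge_transform_of_width_eq (by omega) hN₂ hM₂ (by omega) (by omega) hK

theorem burge_transform_step (h : BurgeRange a b α β (N₂ - N₁) (N₂ - N₁ + (M₂ - M₁)))
    (hx : N₂ - N₁ < a) (hy : N₂ - N₁ + (M₂ - M₁) < β) (hM₁ : 0 ≤ M₁) (hM₂ : 0 ≤ M₂)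
    (hN₂ : 0 ≤ N₂) (h₁ : N₂ < N₁ + M₁) (h₂ : N₁ ≤ N₂ + M₂) (hK : N₁ < K)
    (hN₁_pred : pairGFInt a b (α + a) (β + b) (N₁ - 1) M₁ N₂ M₂ =
      burgeSum K a b α β (N₁ - 1) M₁ N₂ M₂)
    (hM₁_pred : pairGFInt a b (α + a) (β + b) N₁ (M₁ - 1) N₂ M₂ =
      burgeSum K a b α β N₁ (M₁ - 1) N₂ M₂) :
    pairGFInt a b (α + a) (β + b) N₁ M₁ N₂ M₂ = burgeSum K a b α β N₁ M₁ N₂ M₂ := by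
  rw [burgeSum_eq_add h hx hy hM₁ hM₂ h₁ h₂ hK, ← hN₁_pred, ← hM₁_pred]
  obtain ⟨⟩ := h
  exact pairGFInt_eq_add (by omega) (by omega) (by omega) (by omega) (by omega)

/-- Both sides satisfy the same recurrence in the size of either box; it is available until the
endpoints of the two lattice paths collide or the sizes are degenerate. -/
theorem burge_transform (h : BurgeRange a b α β (N₂ - N₁) (N₂ - N₁ + (M₂ - M₁)))
    (h₁ : N₂ ≤ N₁ + M₁) (h₂ : N₁ ≤ N₂ + M₂) (hK₁ : N₁ < K) (hK₂ : N₂ < K) :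
    pairGFInt a b (α + a) (β + b) N₁ M₁ N₂ M₂ = burgeSum K a b α β N₁ M₁ N₂ M₂ := by
  induction hn : (N₁ + M₁ + N₂ + M₂).toNat using Nat.strong_induction_on
    generalizing N₁ M₁ N₂ M₂ with
  | _ n ih =>
  by_cases hneg : N₁ < 0 ∨ M₁ < 0 ∨ N₂ < 0 ∨ M₂ < 0
  · exact burge_transform_of_neg hneg
  have hrange := h
  have hswap : BurgeRange b a β α (N₁ - N₂) (N₁ - N₂ + (M₁ - M₂)) := by
    obtain ⟨⟩ := h
    constructor <;> omega
  obtain ⟨⟩ := h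
  by_cases hleft : N₂ - N₁ = a ∧ N₂ - N₁ + (M₂ - M₁) = -α
  · exact burge_transform_of_sub_eq_left hleft.1 hleft.2
  by_cases hright : N₂ - N₁ = -b ∧ N₂ - N₁ + (M₂ - M₁) = β
  · rw [pairGFInt_swap, burgeSum_swap]
    exact burge_transform_of_sub_eq_left (by omega) (by omega)
  by_cases hfirst : N₂ < N₁ + M₁ ∧ N₂ - N₁ < a ∧ N₂ - N₁ + (M₂ - M₁) < β
  · refine burge_transform_step hrange hfirst.2.1 hfirst.2.2 (by omega) (by omega) (by omega)
      hfirst.1 h₂ hK₁ (ih _ ?_ ?_ ?_ ?_ ?_ hK₂ rfl) (ih _ ?_ ?_ ?_ ?_ hK₁ hK₂ rfl) <;>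
      first | omega | (constructor <;> omega)
  by_cases hsecond : N₁ < N₂ + M₂ ∧ -b < N₂ - N₁ ∧ -α < N₂ - N₁ + (M₂ - M₁)
  · rw [pairGFInt_swap, burgeSum_swap]
    refine burge_transform_step hswap (by omega) (by omega) (by omega) (by omega) (by omega)
      hsecond.1 h₁ hK₂ ?_ ?_ <;> rw [pairGFInt_swap, burgeSum_swap] <;>
      refine ih _ ?_ ?_ ?_ ?_ ?_ ?_ rfl <;> first | omega | (constructor <;> omega)
  by_cases hlast : N₁ = N₂ + M₂
  · exact burge_transform_of_eq_add hrange (by omega) (by omega) (by omega) h₁ hlast hleft hright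
      (by omega) hK₂
  · rw [pairGFInt_swap, burgeSum_swap]
    exact burge_transform_of_eq_add hswap (by omega) (by omega) (by omega) h₂ (by omega)
      (by omega) (by omega) (by omega) hK₁

end BurgeTransform

section EqualNumberOfParts

open PowerSeries

variable {a b α β : ℤ}

theorem burgeSum_succ_eq_sum_reflect {N n : ℕ} {M₁ N₂ M₂ : ℤ} (hn : n ≤ N)
    (h : ∀ x ≤ N, n < x → burgeTerm a b α β N M₁ N₂ M₂ (N - x) = 0) :
    burgeSum (N + 1) a b α β N M₁ N₂ M₂ =
      ∑ x ∈ Finset.range (n + 1), burgeTerm a b α β N M₁ N₂ M₂ (N - x) := by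
  rw [burgeSum, ← Finset.sum_range_reflect, add_tsub_cancel_right]
  refine (Finset.sum_subset (Finset.range_subset_range.2 (by omega)) fun x hx hx' => ?_).symm
  rw [Finset.mem_range] at hx hx'
  exact h x (by omega) (by omega)

theorem pairGF_eq_sum (ha : 0 ≤ a) (hb : 0 ≤ b) (hα : 0 ≤ α) (hβ : 0 ≤ β)
    (hab : 0 < a + b) (hαβ : 0 < α + β) (N M : ℕ) :
    pairGF N M N M a b (α + a) (β + b) = ∑ x ∈ Finset.range (min M N + 1),
      X ^ (x ^ 2) * gauss (2 * M + N - x) (N - x) * pairGF x (M - x) x (M - x) a b α β := by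
  rw [← pairGFInt_natCast, burge_transform (K := N + 1) (by constructor <;> omega) (by omega)
    (by omega) (by omega) (by omega),
    burgeSum_succ_eq_sum_reflect (min_le_right M N) fun x hx hx' => burgeTerm_of_neg (by omega)]
  refine Finset.sum_congr rfl fun x hx => ?_
  rw [Finset.mem_range] at hx
  have hNx : ((N - x : ℕ) : ℤ) = N - x := by omega
  have hMx : ((M - x : ℕ) : ℤ) = M - x := by omega
  rw [burgeTerm, hNx, ← pairGFInt_natCast, hMx, sub_sub_cancel,
    show (M : ℤ) - N + (N - x) = M - x by ring, show (M : ℤ) + M + (N - x) = 2 * M + N - x by ring,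
    ← sq, ← Nat.cast_pow, Int.toNat_natCast]

/-- The generating function of the pairs `(q, p)` with `n - 1` parts of size at most `w`,
`p_i ≥ q_i` and `q_i ≥ p_{i + 2 - P} + 2 - P'`.  The value at `n = 0` is the one for which
`orderedGF_eq_sum` holds without exceptions. -/
noncomputable def orderedGF (w n P P' : ℕ) : PowerSeries ℤ :=
  if n = 0 then (if w = 0 then 1 else 0)
  else pairGF (n - 1) w (n - 1) w 1 ((P : ℤ) - 1) 1 ((P' : ℤ) - 1)

theorem orderedGF_zero (w P P' : ℕ) : orderedGF w 0 P P' = if w = 0 then 1 else 0 := rfl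

theorem orderedGF_zero_succ {n P P' : ℕ} (hP' : 2 ≤ P') : orderedGF 0 (n + 1) P P' = 1 := by
  rw [orderedGF, if_neg n.succ_ne_zero, ← pairGFInt_natCast, Nat.cast_zero,
    pairGFInt_eq_gauss_of_lt (by omega) le_rfl (by omega) (by omega) (by omega), zero_add,
    gauss_self]

theorem orderedGF_eq_pairGFInt {P : ℕ} (hP : 1 ≤ P) (w n P' : ℕ) :
    orderedGF w (n + 1) P P' = pairGFInt 0 P 1 (P' - 1) ((n : ℤ) + 1) w n w := by
  have hcons : pairGF (n + 1) w n w 0 ((P : ℤ) - 1 + 1) 1 (P' - 1) =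
      pairGF n w n w 1 (P - 1) 1 (P' - 1) :=
    pairSum_succ_zero_add_one (by omega) _
  rw [orderedGF, if_neg n.succ_ne_zero, add_tsub_cancel_right, ← hcons, sub_add_cancel,
    ← pairGFInt_natCast, Nat.cast_succ]

theorem burgeTerm_eq_orderedGF {w N x P P' : ℕ} (hP : 1 ≤ P) (hP' : 1 ≤ P') (hxw : x < w)
    (hxN : x ≤ N) :
    burgeTerm 0 P 1 (P' - 1) (N + 1) w N w (N - x) =
      X ^ ((x + 1) * x) * gauss (2 * w + N - x) (N - x) * orderedGF (w - (x + 1)) (x + 1) P P' := by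
  have hNx : ((N - x : ℕ) : ℤ) = N - x := by omega
  have hwx : ((w - (x + 1) : ℕ) : ℤ) = w - (x + 1) := by omega
  have exponent : ((N : ℤ) + 1 - (N - x)) * (N - (N - x)) = ((x + 1) * x : ℕ) := by
    push_cast
    ring
  have collision : pairGFInt 0 P 1 (P' - 1) ((N : ℤ) + 1 - (N - x) - 1) (w - N + (N - x))
      (N - (N - x)) (w - (N + 1) + (N - x)) = 0 :=
    pairGFInt_eq_zero_of_sub_eq_left (by ring) (by ring)
  rw [burgeTerm, orderedGF_eq_pairGFInt hP, hNx, hwx, exponent, Int.toNat_natCast,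
    pairGFInt_eq_add le_rfl (by omega) (by omega) (by omega) (by omega), collision, mul_zero,
    zero_add]
  congr 1
  · congr 2
    ring
  · congr 1 <;> ring

theorem orderedGF_eq_sum (w n : ℕ) {P P' : ℕ} (hP : 1 ≤ P) (hP' : 1 ≤ P') :
    orderedGF w n P (P' + P) = ∑ x ∈ Finset.range (min w n + 1),
      X ^ (x * (x - 1)) * gauss (2 * w + n - x) (n - x) * orderedGF (w - x) x P P' := by
  rcases n with _ | N
  · have hgauss : gauss (2 * (w : ℤ)) 0 = 1 := mod_cast gauss_zero_right (2 * w)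
    simp [orderedGF_zero, hgauss]
  rcases w.eq_zero_or_pos with rfl | hw
  · have hgauss : gauss ((N : ℤ) + 1) (N + 1) = 1 := mod_cast gauss_self (N + 1)
    simp [orderedGF_zero_succ (P' := P' + P) (by omega), orderedGF_zero, hgauss]
  have transform : orderedGF w (N + 1) P (P' + P) =
      burgeSum (N + 1 + 1) 0 P 1 (P' - 1) (N + 1 : ℕ) w N w := by
    rw [← burge_transform (by constructor <;> omega) (by omega) (by omega) (by omega) (by omega),
      orderedGF_eq_pairGFInt hP, Nat.cast_succ, Nat.cast_add, add_zero, add_sub_right_comm]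
  rw [transform, burgeSum_succ_eq_sum_reflect (min_le_right w (N + 1)) fun x hx hx' =>
    burgeTerm_of_neg (by omega)]
  refine Finset.sum_congr rfl fun x hx => ?_
  rw [Finset.mem_range] at hx
  rcases x with _ | x
  · rw [burgeTerm_of_neg (by omega), Nat.sub_zero, orderedGF_zero, if_neg hw.ne', mul_zero]
  · rw [Nat.add_sub_add_right, Nat.cast_succ, burgeTerm_eq_orderedGF hP hP' (by omega) (by omega),
      add_tsub_cancel_right]
    congr 3 <;> push_cast <;> ring

end EqualNumberOfParts

section GaussExt

open PowerSeries

theorem qFact_add_mul_invQFact (m k : ℕ) :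
    qFact (m + k) * invQFact m = ∏ i ∈ Finset.range k, (1 - X ^ (m + i + 1)) := by
  rw [qFact, Finset.prod_range_add, mul_right_comm]
  change qFact m * invQFact m * _ = _
  rw [qFact_mul_invQFact, one_mul]

theorem tendsto_X_pow_atTop_zero : Tendsto (fun n : ℕ => (X : PowerSeries ℤ) ^ n) atTop (𝓝 0) := by
  rw [PowerSeries.WithPiTopology.tendsto_iff_coeff_tendsto]
  intro d
  refine tendsto_const_nhds.congr' ?_
  filter_upwards [eventually_gt_atTop d] with n hn
  rw [coeff_X_pow, if_neg hn.ne, map_zero]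

theorem tendsto_qFact_add_mul_invQFact (k : ℕ) :
    Tendsto (fun m : ℕ => qFact (m + k) * invQFact m) atTop (𝓝 1) := by
  simp only [qFact_add_mul_invQFact]
  rw [← Finset.prod_const_one (s := Finset.range k)]
  refine tendsto_finsetProd _ fun i _ => ?_
  have hX : Tendsto (fun m : ℕ => (X : PowerSeries ℤ) ^ (m + (i + 1))) atTop (𝓝 0) :=
    tendsto_X_pow_atTop_zero.comp (tendsto_add_atTop_nat (i + 1))
  simpa [add_assoc] using tendsto_const_nhds.sub hX

/-- The Gaussian polynomial `[2 w + n - x ; n - x]` and its limits for `w = ∞` and `n = ∞`. -/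
noncomputable def gaussExt (w n : ℕ∞) (x : ℕ) : PowerSeries ℤ :=
  if w = ⊤ then invQFact (n.toNat - x) else if n = ⊤ then invQFact (2 * w.toNat)
  else gauss (2 * w.toNat + n.toNat - x) (n.toNat - x)

theorem gaussExt_natCast (w n x : ℕ) : gaussExt w n x = gauss (2 * w + n - x) (n - x) := by
  simp [gaussExt]

theorem gaussExt_top_left (n x : ℕ) : gaussExt ⊤ n x = invQFact (n - x) := by
  simp [gaussExt]

theorem gaussExt_top_right (w x : ℕ) : gaussExt w ⊤ x = invQFact (2 * w) := by
  simp [gaussExt]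

theorem gaussExt_natCast_of_le {w n x : ℕ} (hx : x ≤ n) :
    gaussExt w n x = qFact (2 * w + (n - x)) * invQFact (n - x) * invQFact (2 * w) := by
  rw [gaussExt_natCast, ← gauss_natCast_add]
  congr 1 <;> push_cast [hx] <;> ring

theorem tendsto_gaussExt_left {n x : ℕ} (hx : x ≤ n) :
    Tendsto (fun M : ℕ => gaussExt M n x) atTop (𝓝 (gaussExt ⊤ n x)) := by
  simp only [gaussExt_natCast_of_le hx, gaussExt_top_left, mul_right_comm _ (invQFact (n - x))]
  simpa only [one_mul, Function.comp_def, id] using ((tendsto_qFact_add_mul_invQFact (n - x)).comp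
    (tendsto_id.const_mul_atTop' two_pos)).mul_const (invQFact (n - x))

theorem tendsto_gaussExt_right (w x : ℕ) :
    Tendsto (fun M : ℕ => gaussExt w M x) atTop (𝓝 (gaussExt w ⊤ x)) := by
  have eventually_eq : (fun M : ℕ => qFact ((M - x) + 2 * w) * invQFact (M - x) * invQFact (2 * w))
      =ᶠ[atTop] fun M : ℕ => gaussExt w M x := by
    filter_upwards [eventually_ge_atTop x] with M hM
    rw [gaussExt_natCast_of_le hM, add_comm (2 * w)]
  rw [gaussExt_top_right, ← one_mul (invQFact (2 * w))]
  exact (((tendsto_qFact_add_mul_invQFact (2 * w)).comp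
    (tendsto_sub_atTop_nat x)).mul tendsto_const_nhds).congr' eventually_eq

end GaussExt

section FermSum

open PowerSeries

/-- The operator `V ↦ ∑ x, q ^ e(x) [2 w + n - x ; n - x] V(w - x, x)` of the Burge transform, on
functions of `w` and `n` that may be infinite. -/
noncomputable def burgeStep (e : ℕ → ℕ) (V : ℕ∞ → ℕ∞ → PowerSeries ℤ) (w n : ℕ∞) :
    PowerSeries ℤ :=
  ∑ x ∈ Finset.range ((min w n).toNat + 1), X ^ e x * gaussExt w n x * V (w - x) x

/-- The contribution of a part `x` to the exponent, at a level `k ≤ u` or `k > u`; the first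
argument is the number `u + 1 - k` (truncated) of levels of the first kind that are left. -/
def levelExponent : ℕ → ℕ → ℕ
  | 0, x => x * (x - 1)
  | _ + 1, x => x ^ 2

/-- The passage from one level to the next.  The first argument is the number of levels `k ≤ u`
that are left, including the present one, and `V` is the contribution of the next level. -/
noncomputable def tailSum :
    ℕ → (ℕ → ℕ∞ → ℕ∞ → PowerSeries ℤ) → ℕ∞ → ℕ∞ → PowerSeries ℤ
  | 0, V, w, n => if n = 0 then (if w = 0 then 1 else 0) else V 0 (n - 1) (w + 1)
  | 1, V, w, n => X ^ n.toNat * (if w = 0 then (if n = 0 then 1 else 0) else V 0 (w - 1) (n + 1))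
  | u + 2, V, w, n => V (u + 1) n w

/-- The sum over all sequences of partitions with prescribed numbers of parts. -/
noncomputable def fermSum : List ℕ → ℕ → ℕ∞ → ℕ∞ → PowerSeries ℤ
  | [], _ => fun _ n => if n = 1 then 1 else 0
  | f :: fs, u => (burgeStep (levelExponent u))^[f] (tailSum u (fermSum fs))

variable {fs : List ℕ} {u : ℕ}

theorem burgeStep_natCast (e : ℕ → ℕ) (V : ℕ∞ → ℕ∞ → PowerSeries ℤ) (w n : ℕ) :
    burgeStep e V w n = ∑ x ∈ Finset.range (min w n + 1),
      X ^ e x * gauss (2 * w + n - x) (n - x) * V (w - x : ℕ) x := by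
  have hmin : (min (w : ℕ∞) n).toNat = min w n := by
    rw [← Nat.mono_cast.map_min, ENat.toNat_natCast]
  simp only [burgeStep, hmin, gaussExt_natCast, ENat.natCast_sub]

theorem iterate_burgeStep_natCast {e : ℕ → ℕ} {V : ℕ∞ → ℕ∞ → PowerSeries ℤ}
    (G : ℕ → ℕ → ℕ → PowerSeries ℤ) (hzero : ∀ w n : ℕ, V w n = G 0 w n)
    (hsucc : ∀ f w n : ℕ, G (f + 1) w n = ∑ x ∈ Finset.range (min w n + 1),
      X ^ e x * gauss (2 * w + n - x) (n - x) * G f (w - x) x) (f w n : ℕ) :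
    (burgeStep e)^[f] V w n = G f w n := by
  induction f generalizing w n with
  | zero => exact hzero w n
  | succ f ih =>
    rw [Function.iterate_succ_apply', burgeStep_natCast, hsucc]
    exact Finset.sum_congr rfl fun x _ => by rw [ih]

/-- The pair obtained from `z` by attaching the partial quotients of the list in front of its
continued fraction. -/
def evalFrac (z : ℕ × ℕ) : List ℕ → ℕ × ℕ
  | [] => z
  | c :: l => (c * (evalFrac z l).1 + (evalFrac z l).2, (evalFrac z l).1)

/-- The pair with continued fraction `(f_1, …, f_k + 2)`. -/
def levelFrac (fs : List ℕ) : ℕ × ℕ :=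
  evalFrac (1, 2) fs

theorem levelFrac_cons (f : ℕ) (fs : List ℕ) :
    levelFrac (f :: fs) = (f * (levelFrac fs).1 + (levelFrac fs).2, (levelFrac fs).1) := rfl

theorem levelFrac_pos (fs : List ℕ) : 0 < (levelFrac fs).1 ∧ 0 < (levelFrac fs).2 := by
  induction fs with
  | nil => exact ⟨one_pos, two_pos⟩
  | cons f fs ih => exact ⟨Nat.add_pos_right _ ih.2, ih.1⟩

theorem orderedGF_conj {P P' : ℕ} (hP : 0 < P) (hP' : 0 < P') (w n : ℕ) :
    orderedGF w (n + 1) P P' = orderedGF n (w + 1) P' P := by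
  simp only [orderedGF, Nat.succ_ne_zero, if_false, add_tsub_cancel_right]
  exact pairSum_conj (by omega) (by omega) (by omega) (by omega) (by omega) (by omega) _

theorem tailSum_zero_eq_orderedGF
    (h : ∀ w n : ℕ,
      fermSum fs 0 w (n + 1 : ℕ) = orderedGF w (n + 1) (levelFrac fs).2 (levelFrac fs).1)
    (w n : ℕ) :
    tailSum 0 (fermSum fs) w n = orderedGF w n (levelFrac fs).1 (levelFrac fs).2 := by
  rcases n with _ | n
  · simp [tailSum, orderedGF_zero]
  · rw [orderedGF_conj (levelFrac_pos fs).1 (levelFrac_pos fs).2, ← h, tailSum, if_neg (by simp)]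
    rfl

theorem fermSum_zero_eq_orderedGF (fs : List ℕ) (w n : ℕ) :
    fermSum fs 0 w (n + 1 : ℕ) = orderedGF w (n + 1) (levelFrac fs).2 (levelFrac fs).1 := by
  induction fs generalizing w n with
  | nil =>
    have terminal : pairGF w n w n 1 0 1 1 = if n = 0 then 1 else 0 :=
      (pairSum_one_zero_one_one _).trans (by simp)
    change _ = orderedGF w (n + 1) 2 1
    rw [orderedGF_conj two_pos one_pos]
    norm_num [fermSum, orderedGF, terminal]
  | cons f fs ih =>
    refine iterate_burgeStep_natCast
      (fun f w n => orderedGF w n (levelFrac fs).1 (f * (levelFrac fs).1 + (levelFrac fs).2))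
      (fun w n => ?_) (fun f w n => ?_) f w (n + 1)
    · rw [zero_mul, zero_add]
      exact tailSum_zero_eq_orderedGF ih w n
    · obtain ⟨hP, hP'⟩ := levelFrac_pos fs
      rw [add_one_mul, add_right_comm]
      exact orderedGF_eq_sum w n hP (by omega)

/-- The parameters `a, b, α, β` of the restricted partition pairs that belong to a sequence of
numbers of parts. -/
structure BurgeParams where
  (a b α β : ℕ)

/-- The parameters that belong to the numbers of parts in the list, where the second argument is the
number of levels `k ≤ u` that are left; the value is meaningless if it is `0` or exceeds the length
of the list. -/
def burgeParams : List ℕ → ℕ → BurgeParams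
  | [], _ => ⟨0, 0, 0, 0⟩
  | _ :: _, 0 => ⟨0, 0, 0, 0⟩
  | f :: fs, 1 => ⟨1, (levelFrac fs).2 - 1, f, (levelFrac fs).1 + f * ((levelFrac fs).2 - 1)⟩
  | f :: fs, u + 2 =>
    let x := burgeParams fs (u + 1)
    ⟨x.α, x.β, x.a + f * x.α, x.b + f * x.β⟩

theorem burgeParams_pos (hu : u + 1 ≤ fs.length) :
    0 < (burgeParams fs (u + 1)).a + (burgeParams fs (u + 1)).b ∧
      0 < (burgeParams fs (u + 1)).α + (burgeParams fs (u + 1)).β := by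
  induction fs generalizing u with
  | nil => simp at hu
  | cons f fs ih =>
    rcases u with _ | u
    · exact ⟨by simp only [burgeParams]; omega,
        Nat.add_pos_right _ (Nat.add_pos_left (levelFrac_pos fs).1 _)⟩
    · obtain ⟨hab, hαβ⟩ := ih (Nat.le_of_succ_le_succ hu)
      exact ⟨hαβ, hab.trans_le (add_le_add le_self_add le_self_add)⟩

theorem pairGF_one_zero_eq_orderedGF {P P' : ℕ} (hP : 0 < P) (hP' : 0 < P') (n w : ℕ) :
    pairGF n w n w 1 ((P : ℤ) - 1) 0 P' =
      X ^ n * (if w = 0 then (if n = 0 then 1 else 0) else orderedGF (w - 1) (n + 1) P P') := by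
  rcases w with _ | w
  · rw [pairGF, pairSum_box_zero_right (by omega)]
    rcases n with _ | n <;> simp
  · rw [pairGF, pairSum_succ_zero_right (by omega), pairSum_X_pow n fun i j => by ring]
    simp [orderedGF]

theorem tailSum_one_eq_pairGF (fs : List ℕ) (w n : ℕ) :
    tailSum 1 (fermSum fs) w n =
      pairGF n w n w (1 : ℕ) ((levelFrac fs).2 - 1 : ℕ) (0 : ℕ) (levelFrac fs).1 := by
  obtain ⟨hP', hP⟩ := levelFrac_pos fs
  rw [Nat.cast_one, Nat.cast_zero, Nat.cast_sub hP, Nat.cast_one,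
    pairGF_one_zero_eq_orderedGF hP hP']
  rcases w with _ | w
  · simp [tailSum]
  · rw [if_neg w.succ_ne_zero, add_tsub_cancel_right, ← fermSum_zero_eq_orderedGF, tailSum,
      if_neg (by simp), ENat.toNat_natCast]
    rfl

theorem fermSum_cons_eq_pairGF {a b α β : ℕ} (hab : 0 < a + b) (hαβ : 0 < α + β)
    (h : ∀ w n : ℕ, tailSum (u + 1) (fermSum fs) w n = pairGF n w n w a b α β) (f w n : ℕ) :
    fermSum (f :: fs) (u + 1) w n = pairGF n w n w a b (α + f * a : ℕ) (β + f * b : ℕ) := by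
  refine iterate_burgeStep_natCast
    (fun f w n => pairGF n w n w a b (α + f * a : ℕ) (β + f * b : ℕ))
    (fun w n => ?_) (fun f w n => ?_) f w n
  · rw [zero_mul, zero_mul]
    exact h w n
  · have hpos : 0 < α + f * a + (β + f * b) :=
      hαβ.trans_le (add_le_add le_self_add le_self_add)
    rw [add_one_mul, add_one_mul, ← add_assoc, ← add_assoc, Nat.cast_add _ a, Nat.cast_add _ b]
    exact pairGF_eq_sum (by omega) (by omega) (by omega) (by omega) (by omega)
      (by exact_mod_cast hpos) n w

theorem fermSum_eq_pairGF (hu : u + 1 ≤ fs.length) (w n : ℕ) :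
    fermSum fs (u + 1) w n =
      pairGF n w n w (burgeParams fs (u + 1)).a (burgeParams fs (u + 1)).b
        (burgeParams fs (u + 1)).α (burgeParams fs (u + 1)).β := by
  induction fs generalizing u w n with
  | nil => simp at hu
  | cons f fs ih =>
    rcases u with _ | u
    · have hP' := (levelFrac_pos fs).1
      rw [fermSum_cons_eq_pairGF (by omega) (by omega) (tailSum_one_eq_pairGF fs), zero_add,
        mul_one]
      rfl
    · have hu_tail : u + 1 ≤ fs.length := Nat.le_of_succ_le_succ hu
      obtain ⟨hab, hαβ⟩ := burgeParams_pos hu_tail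
      refine fermSum_cons_eq_pairGF hαβ hab (fun w n => ?_) f w n
      exact (ih hu_tail n w).trans
        (pairSum_conj (by omega) (by omega) (by omega) (by omega) (by omega) (by omega) _)

end FermSum

section FermLimit

open PowerSeries

/-- `V w n` tends to `V ∞ n` as `w → ∞`, for all finite `n`. -/
def ContLeft (V : ℕ∞ → ℕ∞ → PowerSeries ℤ) : Prop :=
  ∀ n : ℕ, Tendsto (fun M : ℕ => V M n) atTop (𝓝 (V ⊤ n))

/-- `V w n` tends to `V w ∞` as `n → ∞`, for all finite `w`. -/
def ContRight (V : ℕ∞ → ℕ∞ → PowerSeries ℤ) : Prop :=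
  ∀ w : ℕ, Tendsto (fun M : ℕ => V w M) atTop (𝓝 (V w ⊤))

theorem ContLeft.burgeStep {V : ℕ∞ → ℕ∞ → PowerSeries ℤ} (h : ContLeft V) (e : ℕ → ℕ) :
    ContLeft (burgeStep e V) := by
  intro n
  have eventually_eq : (fun M : ℕ => ∑ x ∈ Finset.range (n + 1),
      X ^ e x * gaussExt M n x * V (M - x : ℕ) x) =ᶠ[atTop]
      fun M : ℕ => Burge.burgeStep e V M n := by
    filter_upwards [eventually_ge_atTop n] with M hM
    rw [Burge.burgeStep, min_eq_right (by exact_mod_cast hM)]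
    simp only [ENat.toNat_natCast, ENat.natCast_sub]
  rw [Burge.burgeStep, min_eq_right le_top, ENat.toNat_natCast]
  refine Tendsto.congr' eventually_eq (tendsto_finsetSum _ fun x hx => ?_)
  rw [ENat.top_sub_natCast]
  exact (tendsto_const_nhds.mul (tendsto_gaussExt_left (Finset.mem_range_succ_iff.1 hx))).mul
    ((h x).comp (tendsto_sub_atTop_nat x))

theorem contRight_burgeStep (V : ℕ∞ → ℕ∞ → PowerSeries ℤ) (e : ℕ → ℕ) :
    ContRight (burgeStep e V) := by
  intro w
  have eventually_eq : (fun M : ℕ => ∑ x ∈ Finset.range (w + 1),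
      X ^ e x * gaussExt w M x * V (w - x) x) =ᶠ[atTop] fun M : ℕ => burgeStep e V w M := by
    filter_upwards [eventually_ge_atTop w] with M hM
    rw [burgeStep, min_eq_left (by exact_mod_cast hM), ENat.toNat_natCast]
  rw [burgeStep, min_eq_left le_top, ENat.toNat_natCast]
  exact Tendsto.congr' eventually_eq (tendsto_finsetSum _ fun x _ =>
    (tendsto_const_nhds.mul (tendsto_gaussExt_right w x)).mul tendsto_const_nhds)

theorem ContLeft.fermSum {fs : List ℕ} {u : ℕ} (h : ContLeft (tailSum u (fermSum fs))) (f : ℕ) :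
    ContLeft (fermSum (f :: fs) u) := by
  rw [Burge.fermSum]
  induction f with
  | zero => exact h
  | succ f ih =>
    rw [Function.iterate_succ_apply']
    exact ih.burgeStep _

theorem contRight_fermSum {f : ℕ} (hf : 0 < f) (fs : List ℕ) (u : ℕ) :
    ContRight (fermSum (f :: fs) u) := by
  obtain ⟨g, rfl⟩ := Nat.exists_eq_add_one.2 hf
  rw [fermSum, Function.iterate_succ']
  exact contRight_burgeStep _ _

theorem contRight_fermSum_nil (u : ℕ) : ContRight (fermSum [] u) := by
  intro w
  refine tendsto_const_nhds.congr' ?_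
  filter_upwards [eventually_gt_atTop 1] with M hM
  have hM_ne : (M : ℕ∞) ≠ 1 := by exact_mod_cast hM.ne'
  simp [fermSum, hM_ne]

theorem contRight_fermSum_zero_singleton : ContRight (fermSum [0] 0) := by
  intro w
  refine tendsto_const_nhds.congr' ?_
  filter_upwards [eventually_gt_atTop 0] with M hM
  simp [fermSum, tailSum, hM.ne']

theorem contLeft_tailSum_zero {V : ℕ → ℕ∞ → ℕ∞ → PowerSeries ℤ} (h : ContRight (V 0)) :
    ContLeft (tailSum 0 V) := by
  intro n
  rcases n with _ | n
  · refine tendsto_const_nhds.congr' ?_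
    filter_upwards [eventually_gt_atTop 0] with M hM
    simp [tailSum, hM.ne']
  · have hpred : ((n + 1 : ℕ) : ℕ∞) - 1 = n := rfl
    have hne : ((n + 1 : ℕ) : ℕ∞) ≠ 0 := by exact_mod_cast n.succ_ne_zero
    simp only [tailSum, hpred, hne, if_false, top_add]
    exact (h n).comp (tendsto_add_atTop_nat 1)

theorem contLeft_tailSum_one {V : ℕ → ℕ∞ → ℕ∞ → PowerSeries ℤ} (h : ContLeft (V 0)) :
    ContLeft (tailSum 1 V) := by
  intro n
  simp only [tailSum, ENat.top_ne_zero, if_false, ENat.top_sub_one, ENat.toNat_natCast]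
  refine tendsto_const_nhds.mul
    (Tendsto.congr' ?_ ((h (n + 1)).comp (tendsto_sub_atTop_nat 1)))
  filter_upwards [eventually_gt_atTop 0] with M hM
  rw [if_neg (by exact_mod_cast hM.ne')]
  rfl

theorem contLeft_fermSum_of_two_le (f₁ : ℕ) {f₂ : ℕ} (hf : 0 < f₂) (fs : List ℕ) (u : ℕ) :
    ContLeft (fermSum (f₁ :: f₂ :: fs) (u + 2)) := by
  have contLeft_tailSum : ContLeft (tailSum (u + 2) (fermSum (f₂ :: fs))) :=
    contRight_fermSum hf fs (u + 1)
  exact contLeft_tailSum.fermSum f₁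

theorem contLeft_fermSum_one {fs : List ℕ} (h : ContRight (fermSum fs 0)) (f₁ f₂ : ℕ) :
    ContLeft (fermSum (f₁ :: f₂ :: fs) 1) :=
  (contLeft_tailSum_one ((contLeft_tailSum_zero h).fermSum f₂)).fermSum f₁

end FermLimit

section ConsUnion

variable {α : Type*}

/-- The injection `(x, l) ↦ x :: l`, used to form `consUnion`. -/
def consEmbedding (α : Type*) : (Σ _ : α, List α) ↪ List α where
  toFun x := x.1 :: x.2
  inj' := by
    rintro ⟨x, l⟩ ⟨y, m⟩ h
    cases h
    rfl

/-- The lists with head `x ∈ s` and tail in `B x`. -/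
def consUnion (s : Finset α) (B : α → Finset (List α)) : Finset (List α) :=
  (s.sigma B).map (consEmbedding α)

theorem cons_mem_consUnion {s : Finset α} {B : α → Finset (List α)} {x : α} {l : List α} :
    x :: l ∈ consUnion s B ↔ x ∈ s ∧ l ∈ B x := by
  rw [consUnion, Finset.mem_map]
  constructor
  · rintro ⟨⟨a, b⟩, h, heq⟩
    cases heq
    exact Finset.mem_sigma.1 h
  · exact fun h => ⟨⟨x, l⟩, Finset.mem_sigma.2 h, rfl⟩

theorem nil_notMem_consUnion {s : Finset α} {B : α → Finset (List α)} : [] ∉ consUnion s B := by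
  simp [consUnion, consEmbedding]

theorem sum_consUnion {A : Type*} [AddCommMonoid A] (s : Finset α) (B : α → Finset (List α))
    (g : List α → A) :
    ∑ l ∈ consUnion s B, g l = ∑ x ∈ s, ∑ l ∈ B x, g (x :: l) := by
  rw [consUnion, Finset.sum_map, Finset.sum_sigma]
  rfl

end ConsUnion

section Levels

open PowerSeries

/-- The last part of the partition `l`, or `n` if there are no parts. -/
def lastPart : ℕ∞ → List ℕ → ℕ∞
  | n, [] => n
  | _, x :: l => lastPart x l

/-- The part with index `i` of the partition `l`, where the part with index `0` is `n`. -/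
def extPart (n : ℕ∞) (l : List ℕ) (i : ℕ) : ℕ∞ := if i = 0 then n else (l.getD (i - 1) 0 : ℕ)

/-- `l` is a partition with `f` parts of size at most `n` and weight at most `w`. -/
structure IsLevel (f : ℕ) (w n : ℕ∞) (l : List ℕ) : Prop where
  length_eq : l.length = f
  sum_le : (l.sum : ℕ∞) ≤ w
  extPart_succ_le : ∀ i < f, extPart n l (i + 1) ≤ extPart n l i

/-- The partitions with `f` parts of size at most `n` and weight at most `w`, which are finite in
number unless `w = n = ∞` (and then the value is meaningless). -/
noncomputable def levelLists : ℕ → ℕ∞ → ℕ∞ → Finset (List ℕ)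
  | 0, _, _ => {[]}
  | f + 1, w, n =>
    consUnion (Finset.range ((min w n).toNat + 1)) fun x => levelLists f (w - x) x

/-- The contribution of a partition to the iterated Burge transform. -/
noncomputable def levelTerm (e : ℕ → ℕ) : ℕ∞ → ℕ∞ → List ℕ → PowerSeries ℤ
  | _, _, [] => 1
  | w, n, x :: l => X ^ e x * gaussExt w n x * levelTerm e (w - x) x l

theorem iterate_burgeStep (e : ℕ → ℕ) (V : ℕ∞ → ℕ∞ → PowerSeries ℤ) (f : ℕ) (w n : ℕ∞) :
    (burgeStep e)^[f] V w n =
      ∑ l ∈ levelLists f w n, levelTerm e w n l * V (w - l.sum) (lastPart n l) := by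
  induction f generalizing w n with
  | zero => simp [levelLists, levelTerm, lastPart]
  | succ f ih =>
    rw [Function.iterate_succ_apply', levelLists, sum_consUnion]
    refine Finset.sum_congr rfl fun x _ => ?_
    rw [ih, Finset.mul_sum]
    refine Finset.sum_congr rfl fun l _ => ?_
    rw [levelTerm, lastPart, List.sum_cons, Nat.cast_add, tsub_add_eq_tsub_tsub, ← mul_assoc]

theorem extPart_cons_succ (n : ℕ∞) (x : ℕ) (l : List ℕ) (i : ℕ) :
    extPart n (x :: l) (i + 1) = extPart x l i := by
  rcases i with _ | i <;> simp [extPart]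

theorem lastPart_eq_extPart (n : ℕ∞) (l : List ℕ) : lastPart n l = extPart n l l.length := by
  induction l generalizing n with
  | nil => simp [lastPart, extPart]
  | cons x l ih => rw [lastPart, ih, List.length_cons, extPart_cons_succ]

theorem eq_top_of_lastPart_eq_top {n : ℕ∞} {l : List ℕ} (h : lastPart n l = ⊤) : n = ⊤ := by
  rcases l with _ | ⟨x, l⟩
  · exact h
  · simp [lastPart_eq_extPart, extPart] at h

theorem natCast_add_le_iff {w : ℕ∞} {x s : ℕ} :
    ((x + s : ℕ) : ℕ∞) ≤ w ↔ (x : ℕ∞) ≤ w ∧ (s : ℕ∞) ≤ w - x := by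
  induction w using ENat.recTopCoe with
  | top => simp
  | coe w =>
    norm_cast
    omega

theorem isLevel_nil {f : ℕ} {w n : ℕ∞} : IsLevel f w n [] ↔ f = 0 := by
  constructor
  · exact fun h => h.length_eq.symm
  · rintro rfl
    exact ⟨rfl, zero_le, fun i hi => absurd hi i.not_lt_zero⟩

theorem isLevel_cons {f : ℕ} {w n : ℕ∞} {x : ℕ} {l : List ℕ} :
    IsLevel (f + 1) w n (x :: l) ↔ ((x : ℕ∞) ≤ w ∧ (x : ℕ∞) ≤ n) ∧ IsLevel f (w - x) x l := by
  have antitone_iff : (∀ i < f + 1, extPart n (x :: l) (i + 1) ≤ extPart n (x :: l) i) ↔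
      (x : ℕ∞) ≤ n ∧ ∀ i < f, extPart x l (i + 1) ≤ extPart x l i := by
    rw [Nat.forall_lt_succ_left']
    simp only [extPart_cons_succ]
    rfl
  constructor
  · rintro ⟨hlen, hsum, hanti⟩
    rw [List.sum_cons, natCast_add_le_iff] at hsum
    rw [antitone_iff] at hanti
    exact ⟨⟨hsum.1, hanti.1⟩, Nat.succ_injective hlen, hsum.2, hanti.2⟩
  · rintro ⟨⟨hw, hn⟩, hlen, hsum, hanti⟩
    exact ⟨congrArg Nat.succ hlen, natCast_add_le_iff.2 ⟨hw, hsum⟩, antitone_iff.2 ⟨hn, hanti⟩⟩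

theorem mem_range_toNat_succ_iff {m : ℕ∞} (hm : m ≠ ⊤) {x : ℕ} :
    x ∈ Finset.range (m.toNat + 1) ↔ (x : ℕ∞) ≤ m := by
  lift m to ℕ using hm
  simp

theorem mem_levelLists {f : ℕ} {w n : ℕ∞} (h : ¬ (w = ⊤ ∧ n = ⊤)) {l : List ℕ} :
    l ∈ levelLists f w n ↔ IsLevel f w n l := by
  induction f generalizing w n l with
  | zero =>
    rw [levelLists, Finset.mem_singleton]
    constructor
    · exact fun hl => hl ▸ isLevel_nil.2 rfl
    · exact fun hl => List.length_eq_zero_iff.1 hl.length_eq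
  | succ f ih =>
    rcases l with _ | ⟨x, l⟩
    · simp [levelLists, nil_notMem_consUnion, isLevel_nil]
    · have hmin : min w n ≠ ⊤ := fun hmin => h (min_eq_top.1 hmin)
      rw [levelLists, cons_mem_consUnion, ih (by simp), isLevel_cons,
        mem_range_toNat_succ_iff hmin, le_min_iff]

end Levels

section Sequences

open PowerSeries

/-- The pair `(w_{k+1}, n_{k+1,0})`, where `w` is the difference `w_k - wt(n^{(k)})`, `n` is the
last part of `n^{(k)}`, and the first argument is the number `u + 1 - k` (truncated). -/
def nextBounds : ℕ → ℕ∞ → ℕ∞ → ℕ∞ × ℕ∞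
  | 0, w, n => (n - 1, w + 1)
  | 1, w, n => (w - 1, n + 1)
  | _ + 2, w, n => (n, w)

/-- The possible continuations of a sequence of partitions, with the arguments of `nextBounds`. -/
def tailSeqs : ℕ → (ℕ → ℕ∞ → ℕ∞ → Finset (List (List ℕ))) → ℕ∞ → ℕ∞ → Finset (List (List ℕ))
  | 0, A, w, n => if n = 0 then (if w = 0 then {[]} else ∅) else A 0 (n - 1) (w + 1)
  | 1, A, w, n => if w = 0 then (if n = 0 then {[]} else ∅) else A 0 (w - 1) (n + 1)
  | u + 2, A, w, n => A (u + 1) n w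

/-- The sequences of partitions with prescribed numbers of parts over which `fermSum` is the sum. -/
noncomputable def admSeqs : List ℕ → ℕ → ℕ∞ → ℕ∞ → Finset (List (List ℕ))
  | [], _, _, n => if n = 1 then {[]} else ∅
  | f :: fs, u, w, n =>
    consUnion (levelLists f w n) fun l => tailSeqs u (admSeqs fs) (w - l.sum) (lastPart n l)

/-- The contribution of a sequence of partitions to `fermSum`. -/
noncomputable def seqTerm : ℕ → ℕ∞ → ℕ∞ → List (List ℕ) → PowerSeries ℤ
  | _, _, _, [] => 1
  | u, w, n, l :: S =>
    levelTerm (levelExponent u) w n l * (if u = 1 then X ^ (lastPart n l).toNat else 1) *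
      seqTerm (u - 1) (nextBounds u (w - l.sum) (lastPart n l)).1
        (nextBounds u (w - l.sum) (lastPart n l)).2 S

theorem tailSum_eq_sum {V : ℕ → ℕ∞ → ℕ∞ → PowerSeries ℤ}
    {A : ℕ → ℕ∞ → ℕ∞ → Finset (List (List ℕ))}
    (h : ∀ u w n, V u w n = ∑ S ∈ A u w n, seqTerm u w n S) (u : ℕ) (w n : ℕ∞) :
    tailSum u V w n = ∑ S ∈ tailSeqs u A w n, (if u = 1 then X ^ n.toNat else 1) *
      seqTerm (u - 1) (nextBounds u w n).1 (nextBounds u w n).2 S := by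
  rw [← Finset.mul_sum]
  rcases u with _ | _ | u
  · by_cases hn : n = 0 <;> by_cases hw : w = 0 <;>
      simp [tailSum, tailSeqs, nextBounds, hn, hw, h, seqTerm]
  · by_cases hn : n = 0 <;> by_cases hw : w = 0 <;>
      simp [tailSum, tailSeqs, nextBounds, hn, hw, h, seqTerm]
  · simp [tailSum, tailSeqs, nextBounds, h]

theorem fermSum_eq_sum (fs : List ℕ) (u : ℕ) (w n : ℕ∞) :
    fermSum fs u w n = ∑ S ∈ admSeqs fs u w n, seqTerm u w n S := by
  induction fs generalizing u w n with
  | nil =>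
    simp only [fermSum, admSeqs]
    split_ifs <;> simp [seqTerm]
  | cons f fs ih =>
    rw [fermSum, iterate_burgeStep, admSeqs, sum_consUnion]
    refine Finset.sum_congr rfl fun l _ => ?_
    rw [tailSum_eq_sum ih, Finset.mul_sum]
    exact Finset.sum_congr rfl fun S _ => by rw [seqTerm, mul_assoc]

theorem nextBounds_ne_top {w n : ℕ∞} (h : ¬ (w = ⊤ ∧ n = ⊤)) (u : ℕ) :
    ¬ ((nextBounds u w n).1 = ⊤ ∧ (nextBounds u w n).2 = ⊤) := by
  rcases u with _ | _ | u <;> simpa [nextBounds, ENat.sub_eq_top_iff, and_comm] using h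

theorem nil_mem_admSeqs {fs : List ℕ} {u : ℕ} {w n : ℕ∞} :
    [] ∈ admSeqs fs u w n ↔ fs = [] ∧ n = 1 := by
  rcases fs with _ | ⟨f, fs⟩
  · simp only [admSeqs]
    split_ifs with h <;> simp [h]
  · simp [admSeqs, nil_notMem_consUnion]

theorem nil_mem_tailSeqs {fs : List ℕ} {u : ℕ} (hu : fs = [] → u = 0) {w n : ℕ∞} :
    [] ∈ tailSeqs u (admSeqs fs) w n ↔ u ≤ 1 ∧ w = 0 ∧ (fs ≠ [] → n = 0) := by
  rcases u with _ | _ | u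
  · by_cases hn : n = 0 <;> by_cases hw : w = 0 <;>
      simp [tailSeqs, nil_mem_admSeqs, hn, hw]
  · have hfs : fs ≠ [] := fun h => one_ne_zero (hu h)
    by_cases hn : n = 0 <;> by_cases hw : w = 0 <;>
      simp [tailSeqs, nil_mem_admSeqs, hn, hw, hfs]
  · have hfs : fs ≠ [] := fun h => (u + 1).succ_ne_zero (hu h)
    simp [tailSeqs, nil_mem_admSeqs, hfs]

theorem mem_tailSeqs_of_ne_nil {A : ℕ → ℕ∞ → ℕ∞ → Finset (List (List ℕ))} {S : List (List ℕ)}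
    (hS : S ≠ []) {u : ℕ} {w n : ℕ∞} :
    S ∈ tailSeqs u A w n ↔ (u = 1 → w ≠ 0) ∧ (u = 0 → n ≠ 0) ∧
      S ∈ A (u - 1) (nextBounds u w n).1 (nextBounds u w n).2 := by
  rcases u with _ | _ | u
  · by_cases hn : n = 0 <;> by_cases hw : w = 0 <;> simp [tailSeqs, nextBounds, hn, hw, hS]
  · by_cases hn : n = 0 <;> by_cases hw : w = 0 <;> simp [tailSeqs, nextBounds, hn, hw, hS]
  · simp [tailSeqs, nextBounds]

end Sequences

section AdmissibleFrom

/-- The conditions of `Admissible` for the last levels of a sequence of partitions, where `u` is the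
number of levels of the first kind that are left (possibly zero) and `T` bounds the number of all
levels that are left.  As the levels are numbered from `1`, the quantifiers run over `k - 1`. -/
structure AdmissibleFrom (f : ℕ → ℕ) (T u : ℕ) (w n : ℕ∞) (S : List (List ℕ)) : Prop where
  ne_nil : S ≠ []
  le_length : u ≤ S.length
  length_le : S.length ≤ T
  isLevel : ∀ k < S.length, IsLevel (f (k + 1)) (wBound f u w n S (k + 1))
    (nExt f u w n S (k + 1) 0) (nPartition S (k + 1))
  wt_lt : ∀ k, k + 1 < S.length → u = k + 1 → (nWt S (k + 1) : ℕ∞) < wBound f u w n S (k + 1)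
  pos : ∀ k, k + 1 < S.length → u ≤ k → 0 < nExt f u w n S (k + 1) (f (k + 1))
  wt_last : (nWt S S.length : ℕ∞) = wBound f u w n S S.length
  last_zero : S.length < T → nExt f u w n S S.length (f S.length) = 0

variable {f : ℕ → ℕ} {T u : ℕ} {w n : ℕ∞} {l : List ℕ} {S : List (List ℕ)}

theorem forall_one_le_le_iff {m : ℕ} {P : ℕ → Prop} :
    (∀ k, 1 ≤ k → k ≤ m → P k) ↔ ∀ k < m, P (k + 1) := by
  constructor
  · exact fun h k hk => h (k + 1) (Nat.le_add_left 1 k) hk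
  · rintro h (_ | k) h_one h_le
    · exact absurd h_one (by decide)
    · exact h k h_le

theorem admissible_iff_admissibleFrom {t : ℕ} (hu : 1 ≤ u) :
    Admissible f t u w n S ↔ AdmissibleFrom f (t + 1) u w n S := by
  constructor
  · intro h
    have length_part := forall_one_le_le_iff.1 h.length_part
    have antitone := forall_one_le_le_iff.1 h.antitone
    have wt_le := forall_one_le_le_iff.1 h.wt_le
    refine ⟨List.length_pos_iff.1 (hu.trans h.le_length), h.le_length, h.length_le, fun k hk => ?_,
      ?_, fun k hk huk => h.pos (k + 1) (by omega) hk, h.wt_last, h.last_zero⟩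
    · exact ⟨length_part k hk, wt_le k hk, forall_one_le_le_iff.1 (antitone k hk)⟩
    · rintro k hk rfl
      exact h.wt_u_lt hk
  · intro h
    obtain ⟨v, rfl⟩ := Nat.exists_eq_add_one.2 hu
    refine ⟨h.le_length, h.length_le, forall_one_le_le_iff.2 fun k hk => (h.isLevel k hk).length_eq,
      forall_one_le_le_iff.2 fun k hk => forall_one_le_le_iff.2 (h.isLevel k hk).extPart_succ_le,
      forall_one_le_le_iff.2 fun k hk => (h.isLevel k hk).sum_le, h.wt_last,
      fun hv => h.wt_lt v hv rfl, ?_, h.last_zero⟩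
    rintro (_ | k) hvk hk
    · exact absurd hvk (Nat.not_lt_zero _)
    · exact h.pos k hk (Nat.le_of_lt_succ hvk)

theorem nPartition_cons_add_two (l : List ℕ) (S : List (List ℕ)) (k : ℕ) :
    nPartition (l :: S) (k + 2) = nPartition S (k + 1) := rfl

theorem nWt_cons_add_two (l : List ℕ) (S : List (List ℕ)) (k : ℕ) :
    nWt (l :: S) (k + 2) = nWt S (k + 1) := rfl

theorem add_one_tsub {s : ℕ} (h : (s : ℕ∞) ≤ w) : w + 1 - s = w - s + 1 := by
  induction w using ENat.recTopCoe with
  | top => simp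
  | coe w =>
    norm_cast at h ⊢
    omega

theorem IsLevel.nExt_one_eq_lastPart (hl : IsLevel (f 1) w n l) (S : List (List ℕ)) (u : ℕ) :
    nExt f u w n (l :: S) 1 (f 1) = lastPart n l := by
  rw [lastPart_eq_extPart, hl.length_eq]
  rfl

theorem IsLevel.bounds_one (hl : IsLevel (f 1) w n l) (S : List (List ℕ)) (u : ℕ) :
    bounds f u w n (l :: S) 1 = nextBounds u (w - l.sum) (lastPart n l) := by
  have hwt : nWt (l :: S) 1 = l.sum := rfl
  have hlast : (if f 1 = 0 then n else (nPart (l :: S) 1 (f 1) : ℕ∞)) = lastPart n l :=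
    hl.nExt_one_eq_lastPart S u
  simp only [bounds, zero_add, hlast, hwt, tsub_right_comm, add_one_tsub hl.sum_le]
  rcases u with _ | _ | u <;> simp [nextBounds]

theorem IsLevel.bounds_succ (hl : IsLevel (f 1) w n l) (S : List (List ℕ)) (u j : ℕ) :
    bounds f u w n (l :: S) (j + 1) = bounds (fun k => f (k + 1)) (u - 1)
      (nextBounds u (w - l.sum) (lastPart n l)).1
      (nextBounds u (w - l.sum) (lastPart n l)).2 S j := by
  induction j with
  | zero => exact hl.bounds_one S u
  | succ j ih =>
    have lt_iff : j + 1 + 1 < u ↔ j + 1 < u - 1 := by omega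
    have eq_iff : j + 1 + 1 = u ↔ j + 1 = u - 1 := by omega
    rw [bounds]
    simp only [ih, lt_iff, eq_iff, nPart, nWt, nPartition_cons_add_two]
    rfl

theorem IsLevel.wBound_add_two (hl : IsLevel (f 1) w n l) (S : List (List ℕ)) (u k : ℕ) :
    wBound f u w n (l :: S) (k + 2) = wBound (fun k => f (k + 1)) (u - 1)
      (nextBounds u (w - l.sum) (lastPart n l)).1
      (nextBounds u (w - l.sum) (lastPart n l)).2 S (k + 1) :=
  congrArg Prod.fst (hl.bounds_succ S u k)

theorem IsLevel.nExt_add_two (hl : IsLevel (f 1) w n l) (S : List (List ℕ)) (u k i : ℕ) :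
    nExt f u w n (l :: S) (k + 2) i = nExt (fun k => f (k + 1)) (u - 1)
      (nextBounds u (w - l.sum) (lastPart n l)).1
      (nextBounds u (w - l.sum) (lastPart n l)).2 S (k + 1) i := by
  simp only [nExt, Nat.add_one_sub_one, ← hl.bounds_succ S u k]
  rfl

theorem admissibleFrom_singleton :
    AdmissibleFrom f (T + 1) u w n [l] ↔ IsLevel (f 1) w n l ∧
      u ≤ 1 ∧ (l.sum : ℕ∞) = w ∧ (0 < T → lastPart n l = 0) := by
  constructor
  · intro h
    have hl : IsLevel (f 1) w n l := h.isLevel 0 Nat.one_pos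
    refine ⟨hl, h.le_length, h.wt_last, fun hT => ?_⟩
    rw [← hl.nExt_one_eq_lastPart [] u]
    exact h.last_zero (Nat.succ_lt_succ hT)
  · rintro ⟨hl, hu, hsum, hlast⟩
    refine ⟨List.cons_ne_nil l [], hu, Nat.le_add_left 1 T, fun k hk => ?_,
      fun k hk => absurd hk (by simp), fun k hk => absurd hk (by simp), hsum, fun hT => ?_⟩
    · obtain rfl := Nat.lt_one_iff.1 hk
      exact hl
    · exact (hl.nExt_one_eq_lastPart [] u).trans (hlast (Nat.lt_of_succ_lt_succ hT))

theorem AdmissibleFrom.isLevel_head (h : AdmissibleFrom f T u w n (l :: S)) :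
    IsLevel (f 1) w n l :=
  h.isLevel 0 (Nat.succ_pos _)

theorem AdmissibleFrom.tail (hS : S ≠ []) (h : AdmissibleFrom f (T + 1) u w n (l :: S)) :
    AdmissibleFrom (fun k => f (k + 1)) T (u - 1) (nextBounds u (w - l.sum) (lastPart n l)).1
      (nextBounds u (w - l.sum) (lastPart n l)).2 S := by
  have hl := h.isLevel_head
  have length_cons : (l :: S).length = S.length + 1 := rfl
  obtain ⟨m, hm⟩ := Nat.exists_eq_add_one.2 (List.length_pos_iff.2 hS)
  obtain ⟨-, le_length, length_le, isLevel, wt_lt, pos, wt_last, last_zero⟩ := h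
  rw [length_cons] at le_length length_le isLevel wt_lt pos wt_last last_zero
  refine ⟨hS, by omega, by omega, fun k hk => ?_, fun k hk huk => ?_, fun k hk huk => ?_, ?_,
    fun hT => ?_⟩
  · simpa only [nPartition_cons_add_two, hl.wBound_add_two, hl.nExt_add_two] using
      isLevel (k + 1) (by omega)
  · simpa only [nWt_cons_add_two, hl.wBound_add_two] using wt_lt (k + 1) (by omega) (by omega)
  · simpa only [hl.nExt_add_two] using pos (k + 1) (by omega) (by omega)
  · rw [hm] at wt_last ⊢
    simpa only [nWt_cons_add_two, hl.wBound_add_two] using wt_last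
  · have last_zero := last_zero (by omega)
    rw [hm] at last_zero ⊢
    simpa only [hl.nExt_add_two] using last_zero

theorem AdmissibleFrom.cons (hl : IsLevel (f 1) w n l) (hsum : u = 1 → (l.sum : ℕ∞) < w)
    (hlast : u = 0 → 0 < lastPart n l)
    (h : AdmissibleFrom (fun k => f (k + 1)) T (u - 1)
      (nextBounds u (w - l.sum) (lastPart n l)).1
      (nextBounds u (w - l.sum) (lastPart n l)).2 S) :
    AdmissibleFrom f (T + 1) u w n (l :: S) := by
  have length_cons : (l :: S).length = S.length + 1 := rfl
  obtain ⟨m, hm⟩ := Nat.exists_eq_add_one.2 (List.length_pos_iff.2 h.ne_nil)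
  obtain ⟨-, le_length, length_le, isLevel, wt_lt, pos, wt_last, last_zero⟩ := h
  refine ⟨List.cons_ne_nil l S, by omega, by omega, ?_, ?_, ?_, ?_, fun hT => ?_⟩
  · rintro (_ | k) hk
    · exact hl
    · simpa only [nPartition_cons_add_two, hl.wBound_add_two, hl.nExt_add_two] using
      isLevel k (by omega)
  · rintro (_ | k) hk huk
    · exact hsum huk
    · simpa only [nWt_cons_add_two, hl.wBound_add_two] using wt_lt k (by omega) (by omega)
  · rintro (_ | k) hk huk
    · exact (hlast (Nat.le_zero.1 huk)).trans_eq (hl.nExt_one_eq_lastPart S u).symm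
    · simpa only [hl.nExt_add_two] using pos k (by omega) (by omega)
  · rw [hm] at wt_last
    rw [length_cons, hm]
    simpa only [nWt_cons_add_two, hl.wBound_add_two] using wt_last
  · have last_zero := last_zero (by omega)
    rw [hm] at last_zero
    rw [length_cons, hm]
    simpa only [hl.nExt_add_two] using last_zero

theorem admissibleFrom_cons (hS : S ≠ []) :
    AdmissibleFrom f (T + 1) u w n (l :: S) ↔ IsLevel (f 1) w n l ∧
      (u = 1 → (l.sum : ℕ∞) < w) ∧ (u = 0 → 0 < lastPart n l) ∧
      AdmissibleFrom (fun k => f (k + 1)) T (u - 1) (nextBounds u (w - l.sum) (lastPart n l)).1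
        (nextBounds u (w - l.sum) (lastPart n l)).2 S := by
  constructor
  · intro h
    have hlen : 1 < (l :: S).length := Nat.succ_lt_succ (List.length_pos_iff.2 hS)
    refine ⟨h.isLevel_head, h.wt_lt 0 hlen, fun hu => ?_, h.tail hS⟩
    exact (h.pos 0 hlen hu.le).trans_eq (h.isLevel_head.nExt_one_eq_lastPart S u)
  · rintro ⟨hl, hsum, hlast, h⟩
    exact h.cons hl hsum hlast

theorem mem_admSeqs (h : ¬ (w = ⊤ ∧ n = ⊤)) (hu : u = 0 ∨ u < T) (hS : S ≠ []) :
    S ∈ admSeqs ((List.range T).map fun k => f (k + 1)) u w n ↔ AdmissibleFrom f T u w n S := by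
  induction S generalizing f T u w n with
  | nil => exact absurd rfl hS
  | cons l S ih =>
    rcases T with _ | T
    · refine iff_of_false ?_ fun h => absurd h.length_le (by simp)
      rw [List.range_zero, List.map_nil, admSeqs]
      split_ifs <;> simp
    · rw [List.range_succ_eq_map, List.map_cons, List.map_map, admSeqs, cons_mem_consUnion,
        mem_levelLists h]
      by_cases hS : S = []
      · subst hS
        have hT : (List.range T).map ((fun k => f (k + 1)) ∘ Nat.succ) ≠ [] ↔ 0 < T := by
          simp [Nat.pos_iff_ne_zero]
        rw [admissibleFrom_singleton, nil_mem_tailSeqs (fun h => by simp at h; omega), hT]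
        refine and_congr_right fun hl => ?_
        rw [tsub_eq_zero_iff_le, hl.sum_le.ge_iff_eq]
      · rw [admissibleFrom_cons hS, mem_tailSeqs_of_ne_nil hS]
        refine and_congr_right fun _ => ?_
        have residual_ne_top : ¬ (w - l.sum = ⊤ ∧ lastPart n l = ⊤) := fun htop =>
          h ⟨(ENat.sub_eq_top_iff.1 htop.1).1, eq_top_of_lastPart_eq_top htop.2⟩
        rw [pos_iff_ne_zero, Ne, tsub_eq_zero_iff_le, not_le, and_congr_right_iff]
        exact fun _ => and_congr_right fun _ =>
          ih (f := fun k => f (k + 1)) (T := T) (nextBounds_ne_top residual_ne_top u) (by omega) hS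

end AdmissibleFrom

section Terms

open PowerSeries

variable {f : ℕ → ℕ} {u T : ℕ} {w n : ℕ∞} {l : List ℕ} {S : List (List ℕ)}

@[to_additive]
theorem prod_Icc_eq_prod_range {A : Type*} [CommMonoid A] (m : ℕ) (g : ℕ → A) :
    ∏ k ∈ Finset.Icc 1 m, g k = ∏ k ∈ Finset.range m, g (k + 1) := by
  rw [Finset.range_eq_Ico, Finset.prod_Ico_add' g 0 m 1]
  rfl

theorem levelTerm_eq (e : ℕ → ℕ) (w n : ℕ∞) (l : List ℕ) :
    levelTerm e w n l = X ^ (∑ i ∈ Finset.range l.length, e (l.getD i 0)) *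
      ∏ i ∈ Finset.range l.length,
        gaussExt (w - (∑ j ∈ Finset.range i, l.getD j 0 : ℕ)) (extPart n l i) (l.getD i 0) := by
  induction l generalizing w n with
  | nil => simp [levelTerm]
  | cons x l ih =>
    rw [levelTerm, ih, List.length_cons, Finset.prod_range_succ', Finset.sum_range_succ', pow_add]
    simp only [extPart_cons_succ, Finset.sum_range_succ', ← tsub_add_eq_tsub_tsub,
      List.getD_cons_succ, List.getD_cons_zero, Nat.cast_add, add_comm (x : ℕ∞)]
    simp only [extPart, Finset.sum_range_zero, Nat.cast_zero, tsub_zero, if_true]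
    ring

/-- The factor of `seqTerm` at level `k`. -/
noncomputable def levelFactor (f : ℕ → ℕ) (u : ℕ) (w n : ℕ∞) (S : List (List ℕ)) (k : ℕ) :
    PowerSeries ℤ :=
  levelTerm (levelExponent (u + 1 - k)) (wBound f u w n S k) (nExt f u w n S k 0)
    (nPartition S k) * if u = k then X ^ (nExt f u w n S k (f k)).toNat else 1

theorem AdmissibleFrom.seqTerm_eq_prod (h : AdmissibleFrom f T u w n S) :
    seqTerm u w n S = ∏ k ∈ Finset.Icc 1 S.length, levelFactor f u w n S k := by
  rw [prod_Icc_eq_prod_range]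
  induction S generalizing f T u w n with
  | nil => exact absurd rfl h.ne_nil
  | cons l S ih =>
    obtain ⟨T, rfl⟩ := Nat.exists_eq_add_one.2 ((Nat.succ_pos _).trans_le h.length_le)
    have hl := h.isLevel_head
    rw [seqTerm, List.length_cons, Finset.prod_range_succ', mul_comm]
    refine congrArg₂ _ ?_ ?_
    · rcases eq_or_ne S [] with rfl | hS
      · simp [seqTerm]
      · rw [ih (h.tail hS)]
        refine Finset.prod_congr rfl fun k _ => ?_
        have exponent_eq : u - 1 + 1 - (k + 1) = u + 1 - (k + 2) := by omega
        have eq_iff : u - 1 = k + 1 ↔ u = k + 2 := by omega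
        simp only [levelFactor, exponent_eq, eq_iff, nPartition_cons_add_two, hl.wBound_add_two,
          hl.nExt_add_two]
    · rw [levelFactor, zero_add, hl.nExt_one_eq_lastPart]
      rfl

/-- The factor of `seqTerm` with Gaussian polynomials at level `k`. -/
noncomputable def levelGauss (f : ℕ → ℕ) (u : ℕ) (w n : ℕ∞) (S : List (List ℕ)) (k : ℕ) :
    PowerSeries ℤ :=
  ∏ i ∈ Finset.range (f k),
    gaussExt (wBound f u w n S k - (∑ j ∈ Finset.range i, nPart S k (j + 1) : ℕ))
      (nExt f u w n S k i) (nPart S k (i + 1))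

theorem levelFactor_eq {k : ℕ} (hk : (nPartition S k).length = f k) :
    levelFactor f u w n S k =
      X ^ (∑ i ∈ Finset.Icc 1 (f k), levelExponent (u + 1 - k) (nPart S k i)) *
        levelGauss f u w n S k * if u = k then X ^ (nExt f u w n S k (f k)).toNat else 1 := by
  rw [levelFactor, levelTerm_eq, hk, sum_Icc_eq_sum_range]
  rfl

theorem sum_levelExponent_eq (hS : u ≤ S.length) :
    ∑ k ∈ Finset.Icc 1 S.length, ∑ i ∈ Finset.Icc 1 (f k), levelExponent (u + 1 - k) (nPart S k i)
      = ∑ k ∈ Finset.Icc 1 u, ∑ i ∈ Finset.Icc 1 (f k), nPart S k i ^ 2 +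
        ∑ k ∈ Finset.Icc (u + 1) S.length, ∑ i ∈ Finset.Icc 1 (f k),
          nPart S k i * (nPart S k i - 1) := by
  have Icc_one (m : ℕ) : Finset.Icc 1 m = Finset.Ioc 0 m := Finset.Icc_add_one_left_eq_Ioc 0 m
  rw [Finset.Icc_add_one_left_eq_Ioc, Icc_one S.length, Icc_one u,
    ← Finset.sum_Ioc_consecutive _ (Nat.zero_le u) hS]
  refine congrArg₂ _ (Finset.sum_congr rfl fun k hk => ?_) (Finset.sum_congr rfl fun k hk => ?_)
  · rw [Nat.sub_add_comm (Finset.mem_Ioc.1 hk).2]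
    rfl
  · rw [Nat.sub_eq_zero_of_le (Finset.mem_Ioc.1 hk).1]
    rfl

theorem AdmissibleFrom.seqTerm_eq (h : AdmissibleFrom f T u w n S) (hu : 1 ≤ u) (hf : 1 ≤ f u) :
    seqTerm u w n S =
      X ^ fermExponent f u (f u) S * ∏ k ∈ Finset.Icc 1 S.length, levelGauss f u w n S k := by
  have length_eq : ∀ k ∈ Finset.Icc 1 S.length, (nPartition S k).length = f k := fun k hk => by
    obtain ⟨h_one, h_le⟩ := Finset.mem_Icc.1 hk
    obtain ⟨j, rfl⟩ := Nat.exists_eq_add_one.2 h_one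
    exact (h.isLevel j h_le).length_eq
  have last_part : (nExt f u w n S u (f u)).toNat = nPart S u (f u) := by
    rw [nExt, if_neg (Nat.one_le_iff_ne_zero.1 hf), ENat.toNat_natCast]
  rw [h.seqTerm_eq_prod, Finset.prod_congr rfl fun k hk => levelFactor_eq (length_eq k hk),
    Finset.prod_mul_distrib, Finset.prod_mul_distrib, Finset.prod_pow_eq_pow_sum,
    sum_levelExponent_eq h.le_length, Finset.prod_ite_eq,
    if_pos (Finset.mem_Icc.2 ⟨hu, h.le_length⟩), last_part, fermExponent]
  ring

theorem sum_range_getD_le_sum (l : List ℕ) (i : ℕ) : ∑ j ∈ Finset.range i, l.getD j 0 ≤ l.sum := by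
  induction l generalizing i with
  | nil => simp
  | cons x l ih =>
    rcases i with _ | i
    · exact Nat.zero_le _
    · simpa [Finset.sum_range_succ', add_comm x] using ih i

theorem levelGauss_of_wBound_eq_top {k : ℕ} (hw : wBound f u w n S k = ⊤) :
    levelGauss f u w n S k = qFactLevel f u w n S k := by
  rw [levelGauss, qFactLevel, prod_Icc_eq_prod_range]
  refine Finset.prod_congr rfl fun i _ => ?_
  rw [hw, ENat.top_sub_natCast, gaussExt, if_pos rfl]
  rfl

theorem gaussExt_eq_gaussFactor {k i : ℕ} (hwt : (nWt S k : ℕ∞) ≤ wBound f u w n S k)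
    (hw : wBound f u w n S k ≠ ⊤) (hn : nExt f u w n S k i ≠ ⊤) :
    gaussExt (wBound f u w n S k - (∑ j ∈ Finset.range i, nPart S k (j + 1) : ℕ))
      (nExt f u w n S k i) (nPart S k (i + 1)) = gaussFactor f u w n S k (i + 1) := by
  have nExt_succ : nExt f u w n S k (i + 1) = nPart S k (i + 1) := rfl
  obtain ⟨W, hW⟩ := ENat.ne_top_iff_exists.1 hw
  obtain ⟨m, hm⟩ := ENat.ne_top_iff_exists.1 hn
  have sum_le : ∑ j ∈ Finset.range i, nPart S k (j + 1) ≤ W := by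
    rw [← hW, Nat.cast_le] at hwt
    exact (sum_range_getD_le_sum (nPartition S k) i).trans hwt
  rw [gaussFactor, add_tsub_cancel_right, sum_Icc_eq_sum_range, Finset.sum_range_succ, nExt_succ,
    ← hW, ← hm, ← ENat.natCast_sub, gaussExt_natCast, Nat.cast_sub sum_le]
  simp only [ENat.toNat_natCast, Nat.cast_sum]
  ring_nf

theorem levelGauss_of_ne_top {k : ℕ} (hwt : (nWt S k : ℕ∞) ≤ wBound f u w n S k)
    (hw : wBound f u w n S k ≠ ⊤) (hn : nExt f u w n S k 0 ≠ ⊤) :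
    levelGauss f u w n S k = ∏ i ∈ Finset.Icc 1 (f k), gaussFactor f u w n S k i := by
  rw [levelGauss, prod_Icc_eq_prod_range]
  refine Finset.prod_congr rfl fun i _ => gaussExt_eq_gaussFactor hwt hw ?_
  rcases i with _ | i
  · exact hn
  · exact ENat.natCast_ne_top _

theorem levelGauss_of_nExt_eq_top {k : ℕ} (hwt : (nWt S k : ℕ∞) ≤ wBound f u w n S k)
    (hw : wBound f u w n S k ≠ ⊤) (hn : nExt f u w n S k 0 = ⊤) (hf : 1 ≤ f k) :
    levelGauss f u w n S k = invQFact (2 * (wBound f u w n S k).toNat) *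
      ∏ i ∈ Finset.Icc 2 (f k), gaussFactor f u w n S k i := by
  obtain ⟨m, hm⟩ := Nat.exists_eq_add_one.2 hf
  have prod_Icc_two : ∏ i ∈ Finset.Icc 2 (f k), gaussFactor f u w n S k i =
      ∏ i ∈ Finset.range m, gaussFactor f u w n S k (i + 2) := by
    rw [hm, Finset.range_eq_Ico, Finset.prod_Ico_add' (gaussFactor f u w n S k) 0 m 2]
    rfl
  rw [prod_Icc_two, levelGauss, hm, Finset.prod_range_succ', mul_comm]
  refine congrArg₂ _ ?_ (Finset.prod_congr rfl fun i _ =>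
    gaussExt_eq_gaussFactor hwt hw (ENat.natCast_ne_top _))
  simp [hn, gaussExt, hw]

theorem nExt_ne_top {j : ℕ} (h : (bounds f u w n S j).2 ≠ ⊤) (i : ℕ) :
    nExt f u w n S (j + 1) i ≠ ⊤ := by
  rcases i with _ | i
  · exact h
  · exact ENat.natCast_ne_top _

theorem bounds_add_one (f : ℕ → ℕ) (u : ℕ) (w n : ℕ∞) (S : List (List ℕ)) (j : ℕ) :
    bounds f u w n S (j + 1) =
      if j + 1 < u then
        (nExt f u w n S (j + 1) (f (j + 1)), wBound f u w n S (j + 1) - nWt S (j + 1))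
      else if j + 1 = u then
        (wBound f u w n S (j + 1) - 1 - nWt S (j + 1), nExt f u w n S (j + 1) (f (j + 1)) + 1)
      else
        (nExt f u w n S (j + 1) (f (j + 1)) - 1, wBound f u w n S (j + 1) + 1 - nWt S (j + 1)) :=
  rfl

theorem bounds_add_one_ne_top {j : ℕ} (hw : wBound f u w n S (j + 1) ≠ ⊤)
    (hn : nExt f u w n S (j + 1) (f (j + 1)) ≠ ⊤) :
    (bounds f u w n S (j + 1)).1 ≠ ⊤ ∧ (bounds f u w n S (j + 1)).2 ≠ ⊤ := by
  rw [bounds_add_one]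
  split_ifs <;> simp [ENat.sub_eq_top_iff, hw, hn]

theorem bounds_ne_top {m j : ℕ} (hw : wBound f u w n S (m + 1) ≠ ⊤) (hf : 1 ≤ f (m + 1))
    (hj : m + 1 ≤ j) : (bounds f u w n S j).1 ≠ ⊤ ∧ (bounds f u w n S j).2 ≠ ⊤ := by
  induction j, hj using Nat.le_induction with
  | base =>
    obtain ⟨i, hi⟩ := Nat.exists_eq_add_one.2 hf
    exact bounds_add_one_ne_top hw (hi ▸ ENat.natCast_ne_top _)
  | succ j _ ih => exact bounds_add_one_ne_top ih.1 (nExt_ne_top ih.2 _)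

theorem AdmissibleFrom.levelGauss_of_nExt_eq_top (h : AdmissibleFrom f T u w n S) {m : ℕ}
    (hm : m < S.length) (hw : wBound f u w n S (m + 1) ≠ ⊤) (hn : nExt f u w n S (m + 1) 0 = ⊤)
    (hf : 1 ≤ f (m + 1) ∨ m + 1 = S.length) :
    levelGauss f u w n S (m + 1) = invQFact (2 * (wBound f u w n S (m + 1)).toNat) *
      ∏ i ∈ Finset.Icc 2 (f (m + 1)), gaussFactor f u w n S (m + 1) i := by
  rcases Nat.eq_zero_or_pos (f (m + 1)) with hf_zero | hf_pos
  · obtain hm_last : m + 1 = S.length := hf.resolve_left (by omega)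
    have wt_last := h.wt_last
    rw [← hm_last, nWt, List.eq_nil_of_length_eq_zero ((h.isLevel m hm).length_eq.trans hf_zero)]
      at wt_last
    simp [← wt_last, levelGauss, hf_zero, invQFact_zero]
  · exact Burge.levelGauss_of_nExt_eq_top (h.isLevel m hm).sum_le hw hn hf_pos

theorem AdmissibleFrom.prod_levelGauss (h : AdmissibleFrom f T u w n S) {m : ℕ}
    (hm : m < S.length) (hw : wBound f u w n S (m + 1) ≠ ⊤) (hn : nExt f u w n S (m + 1) 0 = ⊤)
    (hf : 1 ≤ f (m + 1) ∨ m + 1 = S.length) :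
    ∏ k ∈ Finset.Icc (m + 1) S.length, levelGauss f u w n S k =
      invQFact (2 * (wBound f u w n S (m + 1)).toNat) * gaussLevels f u w n S (m + 1) := by
  have prod_rest : ∏ k ∈ Finset.Icc (m + 1 + 1) S.length, levelGauss f u w n S k =
      ∏ k ∈ Finset.Icc (m + 1 + 1) S.length,
        ∏ i ∈ Finset.Icc (1 + if k = m + 1 then 1 else 0) (f k), gaussFactor f u w n S k i := by
    refine Finset.prod_congr rfl fun k hk => ?_
    obtain ⟨hmk, hkS⟩ := Finset.mem_Icc.1 hk
    obtain ⟨j, rfl⟩ := Nat.exists_eq_add_one.2 (Nat.zero_lt_of_lt hmk)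
    obtain ⟨wBound_ne_top, nExt_ne_top⟩ :=
      bounds_ne_top (j := j) hw (hf.resolve_right (by omega)) (by omega)
    rw [if_neg (by omega), add_zero]
    exact levelGauss_of_ne_top (h.isLevel j hkS).sum_le wBound_ne_top nExt_ne_top
  rw [gaussLevels, ← Finset.insert_Icc_add_one_left_eq_Icc hm, Finset.prod_insert (by simp),
    Finset.prod_insert (by simp), prod_rest, h.levelGauss_of_nExt_eq_top hm hw hn hf, if_pos rfl,
    mul_assoc]

theorem bounds_one_of_one_lt (hu : 1 < u) (n : ℕ∞) (S : List (List ℕ)) :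
    bounds f u ⊤ n S 1 = (nExt f u ⊤ n S 1 (f 1), ⊤) := by
  rw [bounds_add_one, if_pos hu]
  exact congrArg _ (ENat.top_sub_natCast _)

theorem bounds_one_of_eq_one (n : ℕ∞) (S : List (List ℕ)) :
    bounds f 1 ⊤ n S 1 = (⊤, nExt f 1 ⊤ n S 1 (f 1) + 1) := by
  have wBound_one : wBound f 1 ⊤ n S 1 = ⊤ := rfl
  simp [bounds_add_one, wBound_one]

theorem bounds_two_of_eq_one (n : ℕ∞) (S : List (List ℕ)) :
    bounds f 1 ⊤ n S 2 = (nExt f 1 ⊤ n S 2 (f 2) - 1, ⊤) := by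
  have wBound_two : wBound f 1 ⊤ n S 2 = ⊤ := congrArg Prod.fst (bounds_one_of_eq_one n S)
  simp [bounds_add_one, wBound_two]

theorem AdmissibleFrom.three_le_length (h : AdmissibleFrom f T 1 ⊤ n S) : 3 ≤ S.length := by
  have wt_last_ne_top := h.wt_last ▸ ENat.natCast_ne_top _
  by_contra! hS
  have hS_pos := h.le_length
  obtain hS_len | hS_len : S.length = 1 ∨ S.length = 2 := by omega
  · exact wt_last_ne_top (by rw [hS_len]; rfl)
  · exact wt_last_ne_top (by rw [hS_len]; exact congrArg Prod.fst (bounds_one_of_eq_one n S))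

theorem AdmissibleFrom.seqTerm_eq_termOfOneLt {N : ℕ} (hu : 1 < u) (hfu : 1 ≤ f u) (hf : 1 ≤ f 2)
    (h : AdmissibleFrom f T u ⊤ N S) : seqTerm u ⊤ N S = termOfOneLt f u (f u) N S := by
  have hS : 1 < S.length := hu.trans_le h.le_length
  have bounds_one := bounds_one_of_one_lt (f := f) hu N S
  have wBound_two : wBound f u ⊤ N S 2 = nExt f u ⊤ N S 1 (f 1) := congrArg Prod.fst bounds_one
  have nExt_one : nExt f u ⊤ N S 1 (f 1) ≠ ⊤ := nExt_ne_top (j := 0) (ENat.natCast_ne_top N) (f 1)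
  have nExt_two : nExt f u ⊤ N S 2 0 = ⊤ := congrArg Prod.snd bounds_one
  rw [h.seqTerm_eq hu.le hfu, ← Finset.insert_Icc_add_one_left_eq_Icc hS.le,
    Finset.prod_insert (by simp), levelGauss_of_wBound_eq_top rfl,
    h.prod_levelGauss hS (wBound_two ▸ nExt_one) nExt_two (Or.inl hf), wBound_two, termOfOneLt]
  ring

theorem AdmissibleFrom.seqTerm_eq_termOfEqOne {N : ℕ} (hf₁ : 1 ≤ f 1) (hf₃ : 1 ≤ f 3 ∨ T ≤ 3)
    (h : AdmissibleFrom f T 1 ⊤ N S) : seqTerm 1 ⊤ N S = termOfEqOne f (f 1) N S := by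
  have hS : 2 < S.length := h.three_le_length
  have bounds_one := bounds_one_of_eq_one (f := f) N S
  have bounds_two := bounds_two_of_eq_one (f := f) N S
  have wBound_two : wBound f 1 ⊤ N S 2 = ⊤ := congrArg Prod.fst bounds_one
  have wBound_three : wBound f 1 ⊤ N S 3 = nExt f 1 ⊤ N S 2 (f 2) - 1 :=
    congrArg Prod.fst bounds_two
  have nExt_one : nExt f 1 ⊤ N S 1 (f 1) ≠ ⊤ := nExt_ne_top (j := 0) (ENat.natCast_ne_top N) (f 1)
  have nExt_two : nExt f 1 ⊤ N S 2 (f 2) ≠ ⊤ :=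
    nExt_ne_top (by simpa [bounds_one] using nExt_one) (f 2)
  have nExt_three : nExt f 1 ⊤ N S 3 0 = ⊤ := congrArg Prod.snd bounds_two
  have wBound_three_ne_top : wBound f 1 ⊤ N S 3 ≠ ⊤ := by
    rw [wBound_three]
    exact fun htop => nExt_two (ENat.sub_eq_top_iff.1 htop).1
  have toNat_wBound_three : (wBound f 1 ⊤ N S 3).toNat = (nExt f 1 ⊤ N S 2 (f 2)).toNat - 1 := by
    rw [wBound_three, ENat.toNat_sub ENat.one_ne_top, ENat.toNat_one]
  rw [h.seqTerm_eq le_rfl hf₁, ← Finset.insert_Icc_add_one_left_eq_Icc h.le_length,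
    Finset.prod_insert (by simp),
    ← Finset.insert_Icc_add_one_left_eq_Icc (show 1 + 1 ≤ _ from hS.le),
    Finset.prod_insert (by simp), levelGauss_of_wBound_eq_top rfl,
    levelGauss_of_wBound_eq_top wBound_two,
    h.prod_levelGauss hS wBound_three_ne_top nExt_three
      (hf₃.imp_right fun hT => le_antisymm hS (h.length_le.trans hT)),
    toNat_wBound_three, termOfEqOne]
  ring

end Terms

section ContFrac

theorem contFrac_zero_right (s : ℕ) : contFrac s 0 = [] := by
  rw [contFrac, dif_pos rfl]

theorem contFrac_of_ne_zero {s r : ℕ} (hr : r ≠ 0) :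
    contFrac s r = (s / r) :: contFrac r (s % r) := by
  rw [contFrac, dif_neg hr]

theorem evalFrac_append (z : ℕ × ℕ) (l l' : List ℕ) :
    evalFrac z (l ++ l') = evalFrac (evalFrac z l') l := by
  induction l with
  | nil => rfl
  | cons c l ih => rw [List.cons_append, evalFrac, ih, evalFrac]

theorem evalFrac_contFrac {s r : ℕ} (h : s.Coprime r) :
    evalFrac (1, 0) (contFrac s r) = (s, r) := by
  induction r using Nat.strong_induction_on generalizing s with
  | _ r ih =>
    rcases Nat.eq_zero_or_pos r with rfl | hr
    · rw [contFrac_zero_right, (Nat.coprime_zero_right s).1 h, evalFrac]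
    · have coprime_mod : r.Coprime (s % r) := by
        rwa [Nat.coprime_comm, Nat.Coprime, ← Nat.gcd_rec, ← Nat.Coprime, Nat.coprime_comm]
      rw [contFrac_of_ne_zero hr.ne', evalFrac, ih (s % r) (Nat.mod_lt s hr) coprime_mod, mul_comm,
        Nat.div_add_mod]

theorem IsContFrac.evalFrac_eq {s r : ℕ} {l : List ℕ} (h : IsContFrac s r l) :
    evalFrac (1, 0) l = (s, r) := by
  obtain ⟨-, coprime, rfl | ⟨l, e, rfl, contFrac_eq⟩⟩ := h
  · exact evalFrac_contFrac coprime
  · rw [← evalFrac_contFrac coprime, contFrac_eq, evalFrac_append, evalFrac_append]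
    simp [evalFrac]

theorem evalFrac_append_add_two (l : List ℕ) (c : ℕ) :
    evalFrac (1, 0) (l ++ [c + 2]) = levelFrac (l ++ [c]) := by
  rw [levelFrac, evalFrac_append, evalFrac_append]
  simp [evalFrac]

theorem pos_of_contFrac_eq_cons_cons {s r x y : ℕ} {l : List ℕ}
    (h : contFrac s r = x :: y :: l) : 0 < y := by
  have hr : r ≠ 0 := by
    rintro rfl
    simp [contFrac_zero_right] at h
  rw [contFrac_of_ne_zero hr, List.cons.injEq] at h
  have hmod : s % r ≠ 0 := fun hmod => by simp [hmod, contFrac_zero_right] at h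
  rw [contFrac_of_ne_zero hmod, List.cons.injEq] at h
  rw [← h.2.1]
  exact Nat.div_pos (Nat.mod_lt s (Nat.pos_of_ne_zero hr)).le (Nat.pos_of_ne_zero hmod)

theorem IsContFrac.eq_contFrac {s r m : ℕ} {l : List ℕ} (h : IsContFrac s r (l ++ [m + 2])) :
    contFrac s r = l ++ [m + 2] := by
  obtain ⟨-, -, h_eq | ⟨l', e, h_eq, -⟩⟩ := h
  · exact h_eq.symm
  · rw [List.append_cons l'] at h_eq
    simpa using List.append_inj_right' h_eq rfl

theorem evalFrac_eq_burgeParams (pre rest : List ℕ) (d : ℕ) :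
    evalFrac (1, 0) (pre ++ [d]) = ((burgeParams (pre ++ d :: rest) (pre.length + 1)).α,
      (burgeParams (pre ++ d :: rest) (pre.length + 1)).a) := by
  induction pre with
  | nil => simp [evalFrac, burgeParams]
  | cons f pre ih =>
    rw [List.cons_append, evalFrac, ih, Prod.mk.injEq]
    exact ⟨add_comm _ _, rfl⟩

theorem levelFrac_eq_burgeParams (pre rest : List ℕ) (d e : ℕ) :
    levelFrac (pre ++ (d + e) :: rest) =
      ((burgeParams (pre ++ d :: e :: rest) (pre.length + 1)).α +
        (burgeParams (pre ++ d :: e :: rest) (pre.length + 1)).β,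
      (burgeParams (pre ++ d :: e :: rest) (pre.length + 1)).a +
        (burgeParams (pre ++ d :: e :: rest) (pre.length + 1)).b) := by
  induction pre with
  | nil =>
    obtain ⟨A, hA⟩ := Nat.exists_eq_add_one.2 (levelFrac_pos rest).1
    simp only [List.nil_append, List.length_nil, zero_add, burgeParams, levelFrac_cons, hA,
      add_tsub_cancel_right, Prod.mk.injEq]
    constructor <;> ring
  | cons f pre ih =>
    simp only [List.cons_append, List.length_cons, burgeParams, levelFrac_cons, ih, Prod.mk.injEq]
    exact ⟨by ring, trivial⟩

end ContFrac

section Assembly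

variable {c : ℕ → ℕ} {p p' r s t u d : ℕ}

theorem map_fSeq (c : ℕ → ℕ) (v m d : ℕ) :
    (List.range (v + 1 + m + 1)).map (fun k => fSeq c (v + 1) d (k + 1)) =
      (List.range v).map (fun k => c (k + 1)) ++
        d :: (c (v + 1) - d) :: (List.range m).map (fun k => c (v + 1 + k + 1)) := by
  rw [show v + 1 + m + 1 = v + (m + 1 + 1) by ring, List.range_add, List.map_append,
    List.range_succ_eq_map, List.range_succ_eq_map]
  simp only [List.map_map, List.map_cons]
  refine congrArg₂ _ (List.map_congr_left fun k hk => ?_) ?_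
  · rw [fSeq, if_pos (Nat.succ_lt_succ (List.mem_range.1 hk))]
  · simp only [List.cons.injEq]
    refine ⟨by simp [fSeq], by simp [fSeq, add_assoc], List.map_congr_left fun k _ => ?_⟩
    simp only [Function.comp, fSeq]
    rw [if_neg (by omega), if_neg (by omega), if_neg (by omega)]
    exact congrArg c (by omega)

theorem map_range_split (c : ℕ → ℕ) (v m : ℕ) :
    (List.range (v + m)).map (fun k => c (k + 1)) ++ [c (v + m + 1)] =
      (List.range v).map (fun k => c (k + 1)) ++
        c (v + 1) :: (List.range m).map (fun k => c (v + 1 + k + 1)) := by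
  have append_last : (List.range (v + m)).map (fun k => c (k + 1)) ++ [c (v + m + 1)] =
      (List.range (v + (m + 1))).map (fun k => c (k + 1)) := by
    rw [← add_assoc, List.range_succ, List.map_append]
    rfl
  rw [append_last, List.range_add, List.map_append, List.range_succ_eq_map]
  simp only [List.map_map, List.map_cons]
  refine congrArg₂ _ rfl (congrArg₂ _ rfl (List.map_congr_left fun k _ => congrArg c ?_))
  simp only [Function.comp]
  omega

theorem R_eq_fermSum
    (hcf : IsContFrac p' p ((List.range (t - 1)).map (fun k => c (k + 1)) ++ [c t + 2]))
    (hu : 1 ≤ u) (hut : u ≤ t) (hdc : d ≤ c u)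
    (hrs : IsContFrac s r ((List.range (u - 1)).map (fun k => c (k + 1)) ++ [d])) (N M : ℕ) :
    (R N M r ((p : ℤ) - r) s ((p' : ℤ) - s) : PowerSeries ℤ) =
      fermSum ((List.range (t + 1)).map fun k => fSeq c u d (k + 1)) u M N := by
  obtain ⟨v, rfl⟩ := Nat.exists_eq_add_one.2 hu
  obtain ⟨m, rfl⟩ := Nat.exists_eq_add_of_le hut
  have small := hrs.evalFrac_eq
  have large := hcf.evalFrac_eq
  rw [add_tsub_cancel_right, evalFrac_eq_burgeParams _
    ((c (v + 1) - d) :: (List.range m).map fun k => c (v + 1 + k + 1)), List.length_map,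
    List.length_range, ← map_fSeq, Prod.mk.injEq] at small
  rw [evalFrac_append_add_two, add_right_comm, add_tsub_cancel_right, map_range_split,
    ← Nat.add_sub_cancel' hdc, levelFrac_eq_burgeParams, List.length_map, List.length_range,
    ← map_fSeq, small.1, small.2, Prod.mk.injEq] at large
  rw [fermSum_eq_pairGF (by simp; omega), R, coe_genFun, small.1, small.2, ← large.1, ← large.2]
  simp only [Nat.cast_add, add_sub_cancel_left]

theorem IsContFrac.second_pos (ht : 3 ≤ t)
    (hcf : IsContFrac p' p ((List.range (t - 1)).map (fun k => c (k + 1)) ++ [c t + 2])) :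
    0 < c 2 := by
  obtain ⟨m, rfl⟩ := Nat.exists_eq_add_of_le' ht
  have contFrac_eq := hcf.eq_contFrac
  rw [Nat.add_sub_assoc (by decide), List.range_succ_eq_map, List.range_succ_eq_map] at contFrac_eq
  exact pos_of_contFrac_eq_cons_cons contFrac_eq

theorem fSeq_self : fSeq c u d u = d := by simp [fSeq]

theorem fSeq_two_pos
    (hcf : IsContFrac p' p ((List.range (t - 1)).map (fun k => c (k + 1)) ++ [c t + 2]))
    (hu : 1 < u) (hut : u ≤ t) (hd : 1 ≤ d) : 0 < fSeq c u d 2 := by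
  rcases (Nat.succ_le_of_lt hu).eq_or_lt with rfl | hu
  · exact hd.trans_eq fSeq_self.symm
  · rw [fSeq, if_pos hu]
    exact hcf.second_pos (by omega)

theorem fSeq_three_pos_or
    (hcf : IsContFrac p' p ((List.range (t - 1)).map (fun k => c (k + 1)) ++ [c t + 2])) :
    0 < fSeq c 1 d 3 ∨ t + 1 ≤ 3 := by
  rcases le_or_gt t 2 with ht | ht
  · exact Or.inr (Nat.succ_le_succ ht)
  · exact Or.inl (hcf.second_pos ht)

theorem contLeft_fermSum_fSeq_of_one_lt (hu : 1 < u) (hut : u ≤ t) (h : 0 < fSeq c u d 2) :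
    ContLeft (fermSum ((List.range (t + 1)).map fun k => fSeq c u d (k + 1)) u) := by
  obtain ⟨v, rfl⟩ := Nat.exists_eq_add_of_le' hu
  obtain ⟨m, rfl⟩ := Nat.exists_eq_add_one.2 ((Nat.zero_lt_of_lt hu).trans_le hut)
  rw [List.range_succ_eq_map, List.range_succ_eq_map]
  exact contLeft_fermSum_of_two_le _ h _ _

theorem contLeft_fermSum_fSeq_one (ht : 1 ≤ t) (h : 0 < fSeq c 1 d 3 ∨ t + 1 ≤ 3) :
    ContLeft (fermSum ((List.range (t + 1)).map fun k => fSeq c 1 d (k + 1)) 1) := by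
  obtain ⟨m, rfl⟩ := Nat.exists_eq_add_one.2 ht
  rw [List.range_succ_eq_map, List.range_succ_eq_map]
  refine contLeft_fermSum_one ?_ _ _
  rcases m with _ | m
  · exact contRight_fermSum_nil 0
  · rw [List.range_succ_eq_map]
    rcases Nat.eq_zero_or_pos (fSeq c 1 d 3) with fSeq_three | fSeq_three
    · obtain rfl : m = 0 := by omega
      have contRight_singleton : ContRight (fermSum [fSeq c 1 d 3] 0) :=
        fSeq_three ▸ contRight_fermSum_zero_singleton
      exact contRight_singleton
    · exact contRight_fermSum fSeq_three _ 0

theorem mem_admSeqs_iff_admissible (hu : 1 ≤ u) (hut : u ≤ t) (N : ℕ) (S : List (List ℕ)) :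
    S ∈ admSeqs ((List.range (t + 1)).map fun k => fSeq c u d (k + 1)) u ⊤ N ↔
      Admissible (fSeq c u d) t u ⊤ N S := by
  rw [admissible_iff_admissibleFrom hu]
  rcases eq_or_ne S [] with rfl | hS
  · refine iff_of_false ?_ fun h => h.ne_nil rfl
    simp [nil_mem_admSeqs]
  · exact mem_admSeqs (by simp) (Or.inr (Nat.lt_succ_of_le hut)) hS

theorem Admissible.seqTerm_eq_termOfOneLt {N : ℕ} {S : List (List ℕ)} (hu : 1 < u) (hd : 1 ≤ d)
    (hf : 0 < fSeq c u d 2) (h : Admissible (fSeq c u d) t u ⊤ N S) :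
    seqTerm u ⊤ N S = termOfOneLt (fSeq c u d) u d N S := by
  rw [((admissible_iff_admissibleFrom hu.le).1 h).seqTerm_eq_termOfOneLt hu
    (fSeq_self.symm ▸ hd) hf, fSeq_self]

theorem Admissible.seqTerm_eq_termOfEqOne {N : ℕ} {S : List (List ℕ)} (hd : 1 ≤ d)
    (hf : 0 < fSeq c 1 d 3 ∨ t + 1 ≤ 3) (h : Admissible (fSeq c 1 d) t 1 ⊤ N S) :
    seqTerm 1 ⊤ N S = termOfEqOne (fSeq c 1 d) d N S := by
  rw [((admissible_iff_admissibleFrom le_rfl).1 h).seqTerm_eq_termOfEqOne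
    (fSeq_self.symm ▸ hd) hf, fSeq_self]

theorem tendsto_R
    (hcf : IsContFrac p' p ((List.range (t - 1)).map (fun k => c (k + 1)) ++ [c t + 2]))
    (hu : 1 ≤ u) (hut : u ≤ t) (hdc : d ≤ c u)
    (hrs : IsContFrac s r ((List.range (u - 1)).map (fun k => c (k + 1)) ++ [d]))
    (hcont : ContLeft (fermSum ((List.range (t + 1)).map fun k => fSeq c u d (k + 1)) u)) (N : ℕ) :
    Tendsto (fun M : ℕ => (R N M r ((p : ℤ) - r) s ((p' : ℤ) - s) : PowerSeries ℤ)) atTop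
      (𝓝 (∑ S ∈ admSeqs ((List.range (t + 1)).map fun k => fSeq c u d (k + 1)) u ⊤ N,
        seqTerm u ⊤ N S)) := by
  simp only [R_eq_fermSum hcf hu hut hdc hrs, ← fermSum_eq_sum]
  exact hcont N

end Assembly

end Burge

theorem mainTheorem10 (p p' r s t u d N : ℕ) (c : ℕ → ℕ)
    (hp : 0 < p) (hp' : 0 < p') (hcop : Nat.Coprime p p')
    (ht : 1 ≤ t)
    (hcf : Burge.IsContFrac p' p ((List.range (t - 1)).map (fun k => c (k + 1)) ++ [c t + 2]))
    (hu : 1 ≤ u) (hut : u ≤ t) (hd : 1 ≤ d) (hdc : d ≤ c u)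
    (hrs : Burge.IsContFrac s r ((List.range (u - 1)).map (fun k => c (k + 1)) ++ [d])) :
    ∃ hfin : {S | Burge.Admissible (Burge.fSeq c u d) t u ⊤ N S}.Finite,
      (1 < u →
        Tendsto
          (fun M : ℕ => (Burge.R N M r ((p : ℤ) - r) s ((p' : ℤ) - s) : PowerSeries ℤ))
          atTop
          (𝓝 (∑ S ∈ hfin.toFinset, Burge.termOfOneLt (Burge.fSeq c u d) u d N S))) ∧
      (u = 1 →
        Tendsto
          (fun M : ℕ => (Burge.R N M r ((p : ℤ) - r) s ((p' : ℤ) - s) : PowerSeries ℤ))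
          atTop
          (𝓝 (∑ S ∈ hfin.toFinset, Burge.termOfEqOne (Burge.fSeq c u d) d N S))) := by
  have mem_admSeqs := Burge.mem_admSeqs_iff_admissible (c := c) (d := d) hu hut N
  have hfin : {S | Burge.Admissible (Burge.fSeq c u d) t u ⊤ N S}.Finite :=
    (Finset.finite_toSet _).subset fun S hS => Finset.mem_coe.2 ((mem_admSeqs S).2 hS)
  have toFinset_eq : hfin.toFinset = Burge.admSeqs
      ((List.range (t + 1)).map fun k => Burge.fSeq c u d (k + 1)) u ⊤ N := by
    ext S
    rw [mem_admSeqs, Set.Finite.mem_toFinset, Set.mem_ofPred_eq]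
  refine ⟨hfin, fun one_lt => ?_, ?_⟩
  · have fSeq_two := Burge.fSeq_two_pos hcf one_lt hut hd
    rw [Finset.sum_congr rfl fun S hS =>
      ((hfin.mem_toFinset.1 hS).seqTerm_eq_termOfOneLt one_lt hd fSeq_two).symm, toFinset_eq]
    exact Burge.tendsto_R hcf hu hut hdc hrs
      (Burge.contLeft_fermSum_fSeq_of_one_lt one_lt hut fSeq_two) N
  · rintro rfl
    have fSeq_three := Burge.fSeq_three_pos_or (d := d) hcf
    rw [Finset.sum_congr rfl fun S hS =>
      ((hfin.mem_toFinset.1 hS).seqTerm_eq_termOfEqOne hd fSeq_three).symm, toFinset_eq]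
    exact Burge.tendsto_R hcf hu hut hdc hrs (Burge.contLeft_fermSum_fSeq_one ht fSeq_three) N
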